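/- Let $A$ be a $C^*$-algebra (not necessarily unital), let $M$ be a correspondence over $A$ (a right Hilbert $A$-module with a left action of $A$ given by a $*$-homomorphism of $A$ into the adjointable operators on $M$), let $Y$ be a right Hilbert $A$-module, and let $T:Y\to Y\otimes_A M$ be an inner-product preserving adjointable map, where $\otimes_A$ denotes the internal tensor product: the completion of the algebraic tensor product in the inner product $\langle x\otimes m,y\otimes n\rangle=\langle m,\langle x,y\rangle\cdot n\rangle$. Tensor powers are bracketed from the left, so that $X\otimes_A M^{\otimes 0}=X$ and $X\otimes_A M^{\otimes (k+1)}=(X\otimes_A M^{\otimes k})\otimes_A M$. Put $T_k:=T\otimes\mathrm{id}_k:Y\otimes_A M^{\otimes k}\to Y\otimes_A M^{\otimes(k+1)}$, let $(Y_\infty,\iota^k)=\varinjlim(Y\otimes_A M^{\otimes k},T_k)$ be the direct limit of Hilbert modules (the completion of the algebraic direct limit), let $Y_k:=\iota^k(Y\otimes_A M^{\otimes k})\subset Y_\infty$, and let $Z_k:=Y_{k+1}\ominus Y_k$ be the set of elements of $Y_{k+1}$ orthogonal to $Y_k$. Then the following hold. (1) For every $k\ge 0$, $Y_k\subset Y_{k+1}$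 and $Y_k$ is complemented in $Y_{k+1}$ with complement $Z_k$, that is, $Y_{k+1}=Y_k+Z_k$. (2) There is a Hilbert-module direct-sum decomposition \[ Y_\infty=Y_0\oplus\Big(\bigoplus_{k=0}^\infty Z_k\Big); \] that is, let the right-hand side be the Hilbert module of all $(y,(z_k)_{k\ge0})$ with $y\in Y_0$, $z_k\in Z_k$ and $\sum_k\langle z_k,z_k\rangle$ convergent in $A$, with inner product $\langle(y,(z_k)),(y',(z_k'))\rangle=\langle y,y'\rangle+\sum_k\langle z_k,z'_k\rangle$. Then for each such element the series $\sum_k z_k$ converges in $Y_\infty$, and $(y,(z_k))\mapsto y+\sum_k z_k$ is an isomorphism of Hilbert modules onto $Y_\infty$. (3) There is exactly one Hilbert-module isomorphism $R$ of $Y_\infty$ onto $Y_\infty\otimes_A M$ such that $R\circ\iota^{k+1}=\iota^k\otimes\mathrm{id}$ for all $k\ge0$. Define $R^0=\mathrm{id}$ and $R^{k+1}=(R\otimes\mathrm{id}_k)\circ R^k:Y_\infty\to Y_\infty\otimes_A M^{\otimes(k+1)}$. Then for every $k\ge0$ the map $R^k:Y_\infty\to Y_\infty\otimes_A M^{\otimes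 k}$ is an isomorphism, and it restricts to an isomorphism of $Z_k$ onto $Z_0\otimes_A M^{\otimes k}$, where $Z_0\otimes_A M^{\otimes k}$ is regarded as a submodule of $Y_\infty\otimes_A M^{\otimes k}$ through the isometric embedding induced by the inclusion $Z_0\subset Y_\infty$. -/

import Mathlib

open MulOpposite UniformSpace
open scoped TensorProduct

universe u v w

noncomputable section

/-- A (right) Hilbert module over the C⋆-algebra `A`: a Banach space with a right action of `A`
(that is, an action of `Aᵐᵒᵖ`) and an inner product inducing the norm. Mathlib's `CStarModule B E`
is the left-handed notion (`inner x (b • y) = b * inner x y`), so a right module over `A` is a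
`CStarModule` over `Aᵐᵒᵖ`; the `A`-valued inner product is `HilbertModule.ip` below. -/
structure HilbertModule (A : Type v) [NonUnitalCStarAlgebra A] [PartialOrder A]
    [StarOrderedRing A] where
  carrier : Type u
  [normedAddCommGroup : NormedAddCommGroup carrier]
  [normedSpace : NormedSpace ℂ carrier]
  [completeSpace : CompleteSpace carrier]
  [smul : SMul Aᵐᵒᵖ carrier]
  [cstarModule : CStarModule Aᵐᵒᵖ carrier]

namespace HilbertModule

variable {A : Type v} [NonUnitalCStarAlgebra A] [PartialOrder A] [StarOrderedRing A]

instance : CoeSort (HilbertModule.{u} A) (Type u) := ⟨carrier⟩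

attribute [instance] normedAddCommGroup normedSpace completeSpace smul cstarModule

/-- The `A`-valued inner product of a right Hilbert `A`-module, conjugate linear in the first
variable. -/
def ip {X : HilbertModule.{u} A} (x y : X) : A := unop (inner Aᵐᵒᵖ x y)

section
variable {X : HilbertModule.{u} A}

lemma ip_add_right (x y z : X) : ip x (y + z) = ip x y + ip x z := by simp [ip]
lemma ip_add_left (x y z : X) : ip (x + y) z = ip x z + ip y z := by simp [ip]
lemma ip_sub_right (x y z : X) : ip x (y - z) = ip x y - ip x z := by simp [ip]
lemma ip_sub_left (x y z : X) : ip (x - y) z = ip x z - ip y z := by simp [ip]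
lemma ip_smul_right (c : ℂ) (x y : X) : ip x (c • y) = c • ip x y := by simp [ip]
lemma ip_smul_left (c : ℂ) (x y : X) : ip (c • x) y = star c • ip x y := by simp [ip]
lemma star_ip (x y : X) : star (ip x y) = ip y x := by
  rw [ip, ip, ← unop_star, CStarModule.star_inner]
lemma ip_act_right (x y : X) (a : A) : ip x (op a • y) = ip x y * a := by simp [ip]
lemma ip_act_left (x y : X) (a : A) : ip (op a • x) y = star a * ip x y := by simp [ip]
lemma ip_self_nonneg (x : X) : 0 ≤ ip x x :=
  (CStarModule.inner_self_nonneg (A := Aᵐᵒᵖ) (x := x) :)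
lemma ip_self_eq_zero {x : X} : ip x x = 0 ↔ x = 0 := by
  simp [ip, CStarModule.inner_self]
lemma norm_eq (x : X) : ‖x‖ = √‖ip x x‖ := by
  rw [CStarModule.norm_eq_sqrt_norm_inner_self (A := Aᵐᵒᵖ)]; rfl
lemma norm_ip_le (x y : X) : ‖ip x y‖ ≤ ‖x‖ * ‖y‖ :=
  CStarModule.norm_inner_le (A := Aᵐᵒᵖ) X
lemma continuous_ip : Continuous fun p : X × X => ip p.1 p.2 :=
  continuous_unop.comp (CStarModule.continuous_inner (A := Aᵐᵒᵖ))
lemma ip_sum_right {ι : Type*} (s : Finset ι) (x : X) (f : ι → X) :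
    ip x (∑ i ∈ s, f i) = ∑ i ∈ s, ip x (f i) := by
  simp [ip]
lemma ip_sum_left {ι : Type*} (s : Finset ι) (x : X) (f : ι → X) :
    ip (∑ i ∈ s, f i) x = ∑ i ∈ s, ip (f i) x := by
  simp [ip]

end

/-- Build a Hilbert module from an `A`-valued inner product. -/
def ofIp (E : Type u) [NormedAddCommGroup E] [NormedSpace ℂ E] [CompleteSpace E]
    (f : E → E → A) (act : A → E → E)
    (add_right : ∀ x y z, f x (y + z) = f x y + f x z)
    (smul_right : ∀ (c : ℂ) x y, f x (c • y) = c • f x y)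
    (star_f : ∀ x y, star (f x y) = f y x)
    (act_right : ∀ x y a, f x (act a y) = f x y * a)
    (nonneg : ∀ x, 0 ≤ f x x)
    (norm_eq : ∀ x, ‖x‖ = √‖f x x‖) : HilbertModule.{u} A :=
  letI : SMul Aᵐᵒᵖ E := ⟨fun a x => act (unop a) x⟩
  letI : CStarModule Aᵐᵒᵖ E :=
    { inner := fun x y => op (f x y)
      inner_add_right := fun {x y z} => by
        rw [add_right, op_add]
      inner_self_nonneg := fun {x} => (nonneg x :)
      inner_self := fun {x} => by
        rw [op_eq_zero_iff, ← norm_eq_zero (a := x), norm_eq, Real.sqrt_eq_zero (norm_nonneg _),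
          norm_eq_zero]
      inner_op_smul_right := fun {a x y} => by
        change op (f x (act (unop a) y)) = a * op (f x y)
        rw [act_right]; rfl
      inner_smul_right_complex := fun {c x y} => by
        rw [smul_right]; rfl
      star_inner := fun x y => by
        rw [← op_star, star_f]
      norm_eq_sqrt_norm_inner_self := fun x => norm_eq x }
  { carrier := E }

end HilbertModule

open HilbertModule

/-! ### Maps between Hilbert modules -/

section maps

variable {A : Type v} [NonUnitalCStarAlgebra A] [PartialOrder A] [StarOrderedRing A]

/-- Inner-product preserving maps. Such maps are automatically `A`-linear (`IPMap.map_act`). -/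
structure IPMap (X : HilbertModule.{u} A) (Y : HilbertModule.{w} A) extends X →ₗ[ℂ] Y where
  ip_map' : ∀ x y, ip (toFun x) (toFun y) = ip x y

namespace IPMap

variable {X : HilbertModule.{u} A} {Y : HilbertModule.{w} A} {Z : HilbertModule.{w} A}

instance : CoeFun (IPMap X Y) (fun _ => X → Y) := ⟨fun f => f.toLinearMap⟩

lemma ip_map (f : IPMap X Y) (x y : X) : ip (f x) (f y) = ip x y := f.ip_map' x y

lemma norm_map (f : IPMap X Y) (x : X) : ‖f x‖ = ‖x‖ := by
  rw [norm_eq, norm_eq, ip_map]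

lemma isometry (f : IPMap X Y) : Isometry f :=
  AddMonoidHomClass.isometry_of_norm f.toLinearMap f.norm_map

lemma map_act (f : IPMap X Y) (a : A) (x : X) : f (op a • x) = op a • f x := by
  rw [← sub_eq_zero, ← ip_self_eq_zero]
  simp only [ip_sub_left, ip_sub_right, ip_act_left, ip_act_right, ip_map]
  simp [mul_assoc]

/-- The identity map. -/
def id (X : HilbertModule.{u} A) : IPMap X X := ⟨LinearMap.id, fun _ _ => rfl⟩

/-- Composition. -/
def comp (g : IPMap Y Z) (f : IPMap X Y) : IPMap X Z :=
  ⟨g.toLinearMap ∘ₗ f.toLinearMap, fun x y => (g.ip_map _ _).trans (f.ip_map x y)⟩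

/-- `f` has an adjoint. -/
def IsAdjointable (f : IPMap X Y) : Prop :=
  ∃ g : Y → X, ∀ x y, ip (f x) y = ip x (g y)

end IPMap

/-- Isomorphisms of Hilbert modules: inner-product preserving bijections (which are
automatically `A`-linear). -/
structure HilbertIso (X : HilbertModule.{u} A) (Y : HilbertModule.{w} A) extends IPMap X Y where
  surjective' : Function.Surjective toFun

instance {X : HilbertModule.{u} A} {Y : HilbertModule.{w} A} :
    CoeFun (HilbertIso X Y) (fun _ => X → Y) := ⟨fun f => f.toLinearMap⟩

end maps

/-! ### Closed submodules -/

section submodules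

variable {A : Type v} [NonUnitalCStarAlgebra A] [PartialOrder A] [StarOrderedRing A]

/-- Closed `A`-submodules of a Hilbert module. -/
structure HilbertSubmodule (X : HilbertModule.{u} A) extends Submodule ℂ X where
  isClosed' : IsClosed carrier
  act_mem' : ∀ (a : A) {x : X}, x ∈ carrier → op a • x ∈ carrier

namespace HilbertSubmodule

variable {X : HilbertModule.{u} A}

instance : Membership X (HilbertSubmodule X) := ⟨fun V x => x ∈ V.toSubmodule⟩

/-- A closed submodule is a Hilbert module with the restricted operations. -/
def toModule (V : HilbertSubmodule X) : HilbertModule.{u} A :=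
  haveI : CompleteSpace V.toSubmodule := V.isClosed'.completeSpace_coe
  ofIp V.toSubmodule (fun x y => ip (x : X) (y : X)) (fun a x => ⟨op a • (x : X), V.act_mem' a x.2⟩)
    (fun _ _ _ => ip_add_right _ _ _) (fun _ _ _ => ip_smul_right _ _ _) (fun _ _ => star_ip _ _)
    (fun _ _ _ => ip_act_right _ _ _) (fun _ => ip_self_nonneg _) (fun x => norm_eq (x : X))

/-- The inclusion of a closed submodule. -/
def incl (V : HilbertSubmodule X) : IPMap V.toModule X :=
  ⟨V.toSubmodule.subtype, fun _ _ => rfl⟩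

/-- The range of an inner-product preserving map. -/
def range {Y : HilbertModule.{w} A} (f : IPMap Y X) : HilbertSubmodule X where
  toSubmodule := f.toLinearMap.range
  isClosed' := by
    have := f.isometry.isClosedEmbedding.isClosed_range
    rwa [← LinearMap.coe_range] at this
  act_mem' := by
    rintro a _ ⟨y, rfl⟩
    exact ⟨op a • y, f.map_act a y⟩

/-- `W ⊖ V`: the elements of `W` orthogonal to `V`. -/
def ominus (W V : HilbertSubmodule X) : HilbertSubmodule X where
  carrier := {x | x ∈ W ∧ ∀ y ∈ V, ip y x = 0}
  add_mem' := fun hx hy => ⟨W.toSubmodule.add_mem hx.1 hy.1, fun z hz => by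
    rw [ip_add_right, hx.2 z hz, hy.2 z hz, add_zero]⟩
  zero_mem' := ⟨W.toSubmodule.zero_mem, fun z _ => by
    simpa using ip_smul_right 0 z (0 : X)⟩
  smul_mem' := fun c x hx => ⟨W.toSubmodule.smul_mem c hx.1, fun z hz => by
    rw [ip_smul_right, hx.2 z hz, smul_zero]⟩
  isClosed' := by
    have h : {x | x ∈ W ∧ ∀ y ∈ V, ip y x = 0} =
        (W.toSubmodule : Set X) ∩ ⋂ y ∈ {y | y ∈ V}, {x | ip y x = 0} := by
      ext x
      simp only [Set.mem_inter_iff, Set.mem_iInter, Set.mem_ofPred_eq]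
      rfl
    change IsClosed {x | x ∈ W ∧ ∀ y ∈ V, ip y x = 0}
    rw [h]
    refine W.isClosed'.inter (isClosed_biInter fun y _ => ?_)
    exact isClosed_eq (continuous_ip.comp (by fun_prop : Continuous fun x : X => (y, x)))
      continuous_const
  act_mem' := fun a x hx => ⟨W.act_mem' a hx.1, fun z hz => by
    rw [ip_act_right, hx.2 z hz, zero_mul]⟩

end HilbertSubmodule

end submodules

/-! ### Completion of a pre-Hilbert module -/

section completion

variable {A : Type v} [NonUnitalCStarAlgebra A] [PartialOrder A] [StarOrderedRing A]

/-- An `A`-valued positive semidefinite inner product on a complex vector space with a right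
action of `A`. -/
structure PreHilbert (A : Type v) [NonUnitalCStarAlgebra A] [PartialOrder A] [StarOrderedRing A]
    (E : Type u) [AddCommGroup E] [Module ℂ E] where
  ip : E → E → A
  act : A → E →ₗ[ℂ] E
  ip_add_right : ∀ x y z, ip x (y + z) = ip x y + ip x z
  ip_smul_right : ∀ (c : ℂ) x y, ip x (c • y) = c • ip x y
  star_ip : ∀ x y, star (ip x y) = ip y x
  ip_act_right : ∀ x y a, ip x (act a y) = ip x y * a
  ip_self_nonneg : ∀ x, 0 ≤ ip x x

namespace PreHilbert

variable {E : Type u} [AddCommGroup E] [Module ℂ E] (P : PreHilbert A E)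

lemma ip_add_left (x y z : E) : P.ip (x + y) z = P.ip x z + P.ip y z := by
  rw [← P.star_ip, P.ip_add_right, star_add, P.star_ip, P.star_ip]

lemma ip_smul_left (c : ℂ) (x y : E) : P.ip (c • x) y = star c • P.ip x y := by
  rw [← P.star_ip, P.ip_smul_right, star_smul, P.star_ip]

lemma ip_act_left (x y : E) (a : A) : P.ip (P.act a x) y = star a * P.ip x y := by
  rw [← P.star_ip, P.ip_act_right, star_mul, P.star_ip]

lemma isSelfAdjoint_ip (x : E) : IsSelfAdjoint (P.ip x x) := P.star_ip x x

/-- The Cauchy-Schwarz inequality. -/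
lemma norm_ip_sq_le (x y : E) : ‖P.ip x y‖ ^ 2 ≤ ‖P.ip x x‖ * ‖P.ip y y‖ := by
  have key : ∀ n : ℝ, ‖P.ip x x‖ < n → ‖P.ip x y‖ ^ 2 ≤ n * ‖P.ip y y‖ := by
    intro n hn
    have hn0 : 0 < n := (norm_nonneg _).trans_lt hn
    set a := P.ip x y with ha
    have hyx : P.ip y x = star a := by rw [ha, P.star_ip]
    have h := P.ip_self_nonneg (P.act a x + (-(n : ℂ)) • y)
    simp only [P.ip_add_left, P.ip_add_right, P.ip_smul_left, P.ip_smul_right, P.ip_act_left,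
      P.ip_act_right, hyx, ← ha] at h
    have h1 : star a * P.ip x x * a ≤ n • (star a * a) :=
      (CStarAlgebra.star_left_conjugate_le_norm_smul (hb := P.isSelfAdjoint_ip x)).trans
        (smul_le_smul_of_nonneg_right hn.le (star_mul_self_nonneg a))
    have h2 : (0 : A) ≤ n • (n • P.ip y y - star a * a) := by
      have e : ∀ b : A, (n : ℂ) • b = n • b := fun b => Complex.coe_smul n b
      have : (0 : A) ≤ n • (star a * a) + (n • (n • P.ip y y) - (2 : ℝ) • n • (star a * a)) := by
        refine h.trans ?_
        refine le_trans (le_of_eq ?_) (add_le_add_left h1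
          (n • (n • P.ip y y) - (2 : ℝ) • n • (star a * a)))
        simp only [star_neg, neg_smul, Complex.star_def, Complex.conj_ofReal, e, smul_neg, neg_neg,
          mul_assoc, two_smul]
        abel
      refine this.trans (le_of_eq ?_)
      rw [smul_sub, two_smul]; abel
    have h3 : star a * a ≤ n • P.ip y y := by
      rw [← sub_nonneg]
      have := smul_nonneg (inv_nonneg.mpr hn0.le) h2
      rwa [smul_smul, inv_mul_cancel₀ hn0.ne', one_smul] at this
    have h4 := CStarAlgebra.norm_le_norm_of_nonneg_of_le (star_mul_self_nonneg a) h3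
    rw [CStarRing.norm_star_mul_self, norm_smul, Real.norm_of_nonneg hn0.le] at h4
    rwa [sq]
  refine le_of_forall_pos_le_add fun ε hε => ?_
  have hd : 0 < ε / (‖P.ip y y‖ + 1) := by positivity
  refine (key (‖P.ip x x‖ + ε / (‖P.ip y y‖ + 1)) (by linarith)).trans ?_
  rw [add_mul]
  gcongr
  rw [div_mul_eq_mul_div, div_le_iff₀ (by positivity)]
  nlinarith [norm_nonneg (P.ip y y)]

lemma norm_ip_le (x y : E) : ‖P.ip x y‖ ≤ √‖P.ip x x‖ * √‖P.ip y y‖ := by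
  rw [← Real.sqrt_mul (norm_nonneg _)]
  exact Real.le_sqrt_of_sq_le (P.norm_ip_sq_le x y)

lemma triangle (x y : E) :
    √‖P.ip (x + y) (x + y)‖ ≤ √‖P.ip x x‖ + √‖P.ip y y‖ := by
  rw [Real.sqrt_le_left (by positivity)]
  simp only [P.ip_add_left, P.ip_add_right]
  calc ‖P.ip x x + P.ip x y + (P.ip y x + P.ip y y)‖
      ≤ ‖P.ip x x‖ + ‖P.ip x y‖ + (‖P.ip y x‖ + ‖P.ip y y‖) :=
        (norm_add_le _ _).trans (add_le_add (norm_add_le _ _) (norm_add_le _ _))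
    _ ≤ ‖P.ip x x‖ + √‖P.ip x x‖ * √‖P.ip y y‖ + (√‖P.ip y y‖ * √‖P.ip x x‖ + ‖P.ip y y‖) := by
        gcongr <;> exact P.norm_ip_le _ _
    _ = (√‖P.ip x x‖ + √‖P.ip y y‖) ^ 2 := by
        rw [add_sq, Real.sq_sqrt (norm_nonneg _), Real.sq_sqrt (norm_nonneg _)]; ring

/-- The space `E` with the seminorm `‖x‖ = ‖⟨x, x⟩‖ ^ (1/2)`. -/
def Space (_ : PreHilbert A E) : Type u := E

instance : AddCommGroup P.Space := inferInstanceAs (AddCommGroup E)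
instance : Module ℂ P.Space := inferInstanceAs (Module ℂ E)

instance : Norm P.Space := ⟨fun x => √‖P.ip x x‖⟩

lemma norm_def (x : P.Space) : ‖x‖ = √‖P.ip x x‖ := rfl

lemma core : SeminormedSpace.Core ℂ P.Space where
  norm_nonneg _ := Real.sqrt_nonneg _
  norm_smul c x := by
    rw [norm_def, norm_def]
    have : ∀ y : E, P.ip (c • y) (c • y) = star c • c • P.ip y y := fun y => by
      rw [P.ip_smul_left, P.ip_smul_right]
    refine (congrArg (fun t => √‖t‖) (this x)).trans ?_
    rw [norm_smul, norm_smul, norm_star, ← mul_assoc, Real.sqrt_mul (by positivity),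
      Real.sqrt_mul_self (norm_nonneg _)]
  norm_triangle x y := P.triangle x y

instance : SeminormedAddCommGroup P.Space := SeminormedAddCommGroup.ofCore P.core
instance : NormedSpace ℂ P.Space := ⟨fun c x => (P.core.norm_smul c x).le⟩

instance : SMul Aᵐᵒᵖ P.Space := ⟨fun a x => P.act (unop a) x⟩
instance : Inner Aᵐᵒᵖ P.Space := ⟨fun x y => op (P.ip x y)⟩

lemma norm_act_le (a : A) (x : E) : √‖P.ip (P.act a x) (P.act a x)‖ ≤ ‖a‖ * √‖P.ip x x‖ := by
  rw [P.ip_act_left, P.ip_act_right, Real.sqrt_le_left (by positivity),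
    mul_pow, Real.sq_sqrt (norm_nonneg _)]
  calc ‖star a * (P.ip x x * a)‖ ≤ ‖star a‖ * (‖P.ip x x‖ * ‖a‖) :=
        (norm_mul_le _ _).trans (by gcongr; exact norm_mul_le _ _)
    _ = ‖a‖ ^ 2 * ‖P.ip x x‖ := by rw [norm_star]; ring

instance : UniformContinuousConstSMul Aᵐᵒᵖ P.Space where
  uniformContinuous_const_smul a :=
    (LinearMap.mkContinuous (E := P.Space) (F := P.Space) (P.act (unop a)) ‖unop a‖
      (P.norm_act_le (unop a))).uniformContinuous

/-- The inner product as a bounded sesquilinear map. -/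
def ipL : P.Space →L⋆[ℂ] P.Space →L[ℂ] Aᵐᵒᵖ :=
  LinearMap.mkContinuous₂ (LinearMap.mk₂'ₛₗ (starRingEnd ℂ) (RingHom.id ℂ)
    (fun x y : P.Space => op (P.ip x y))
    (fun x y z => congrArg op (P.ip_add_left x y z)) (fun c x y => congrArg op (P.ip_smul_left c x y))
    (fun x y z => congrArg op (P.ip_add_right x y z))
    (fun c x y => congrArg op (P.ip_smul_right c x y))) 1
    (fun x y => by rw [one_mul]; exact P.norm_ip_le x y)

lemma continuous_inner : Continuous fun p : P.Space × P.Space => inner Aᵐᵒᵖ p.1 p.2 :=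
  (by fun_prop : Continuous fun p : P.Space × P.Space => P.ipL p.1 p.2)

lemma inner_coe (x y : P.Space) :
    inner Aᵐᵒᵖ (x : Completion P.Space) (y : Completion P.Space) = inner Aᵐᵒᵖ x y :=
  (Completion.isDenseInducing_coe.prodMap Completion.isDenseInducing_coe).extend_eq
    P.continuous_inner (x, y)

lemma continuous_inner_completion :
    Continuous fun p : Completion P.Space × Completion P.Space => inner Aᵐᵒᵖ p.1 p.2 := by
  let f : P.Space →+ P.Space →+ Aᵐᵒᵖ :=
    { toFun := fun x => ((P.ipL x : P.Space →ₗ[ℂ] Aᵐᵒᵖ)).toAddMonoidHom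
      map_zero' := by ext x; simp
      map_add' := fun x y => by ext z; simp }
  have : Continuous fun p : P.Space × P.Space => f p.1 p.2 := P.continuous_inner
  exact (Completion.isDenseInducing_toCompl P.Space).extend_Z_bilin
    (Completion.isDenseInducing_toCompl P.Space) this

instance : CStarModule Aᵐᵒᵖ (Completion P.Space) where
  inner_add_right {x y z} :=
    Completion.induction_on₃ x y z (by
      have := P.continuous_inner_completion
      exact isClosed_eq (this.comp (by fun_prop : Continuous fun p : Completion P.Space ×
          Completion P.Space × Completion P.Space => (p.1, p.2.1 + p.2.2)))
        ((this.comp (by fun_prop : Continuous fun p : Completion P.Space ×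
          Completion P.Space × Completion P.Space => (p.1, p.2.1))).add
        (this.comp (by fun_prop : Continuous fun p : Completion P.Space ×
          Completion P.Space × Completion P.Space => (p.1, p.2.2))))) fun a b c => by
      rw [← Completion.coe_add, inner_coe, inner_coe, inner_coe]
      exact congrArg op (P.ip_add_right a b c)
  inner_self_nonneg {x} := by
    refine Completion.induction_on x ?_ fun a => ?_
    · have := P.continuous_inner_completion.comp (continuous_id.prodMk continuous_id)
      exact (CStarAlgebra.isClosed_nonneg (A := Aᵐᵒᵖ)).preimage this
    · rw [inner_coe]; exact P.ip_self_nonneg a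
  inner_self {x} := by
    have h : ‖x‖ = √‖inner Aᵐᵒᵖ x x‖ := by
      refine Completion.induction_on x ?_ fun a => ?_
      · have := P.continuous_inner_completion.comp (continuous_id.prodMk continuous_id)
        exact isClosed_eq continuous_norm (Real.continuous_sqrt.comp this.norm)
      · rw [inner_coe, Completion.norm_coe]; rfl
    rw [← norm_eq_zero (a := x), h, Real.sqrt_eq_zero (norm_nonneg _), norm_eq_zero]
  inner_op_smul_right {a x y} :=
    Completion.induction_on₂ x y (by
      have := P.continuous_inner_completion
      have h : Continuous fun z : Completion P.Space => a • z := continuous_const_smul a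
      exact isClosed_eq (this.comp (continuous_fst.prodMk (h.comp continuous_snd)))
        (this.const_mul a)) fun b c => by
      rw [← Completion.coe_smul, inner_coe, inner_coe]
      exact congrArg op (P.ip_act_right b c (unop a))
  inner_smul_right_complex {c x y} :=
    Completion.induction_on₂ x y (by
      have := P.continuous_inner_completion
      exact isClosed_eq (this.comp (continuous_fst.prodMk (continuous_snd.const_smul c)))
        (this.const_smul c)) fun a b => by
      rw [← Completion.coe_smul, inner_coe, inner_coe]
      exact congrArg op (P.ip_smul_right c a b)
  star_inner x y :=
    Completion.induction_on₂ x y (by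
      have := P.continuous_inner_completion
      exact isClosed_eq this.star (this.comp continuous_swap)) fun a b => by
      rw [inner_coe, inner_coe]
      exact congrArg op (P.star_ip a b)
  norm_eq_sqrt_norm_inner_self x := by
    refine Completion.induction_on x ?_ fun a => ?_
    · have := P.continuous_inner_completion.comp (continuous_id.prodMk continuous_id)
      exact isClosed_eq continuous_norm (Real.continuous_sqrt.comp this.norm)
    · rw [inner_coe, Completion.norm_coe]; rfl

/-- The Hilbert module obtained by completing (and dividing out the vectors of length zero). -/
def completion : HilbertModule.{u} A := { carrier := Completion P.Space }

/-- The canonical map of a pre-Hilbert module into its completion. -/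
def toCompletion : E →ₗ[ℂ] P.completion :=
  (Completion.toComplₗᵢ (𝕜 := ℂ) (E := P.Space)).toLinearMap

lemma ip_toCompletion (x y : E) : HilbertModule.ip (P.toCompletion x) (P.toCompletion y) = P.ip x y :=
  congrArg unop (P.inner_coe x y)

lemma denseRange_toCompletion : DenseRange P.toCompletion :=
  Completion.denseRange_coe (α := P.Space)

lemma norm_toCompletion (x : E) : ‖P.toCompletion x‖ = √‖P.ip x x‖ := by
  rw [HilbertModule.norm_eq, ip_toCompletion]

/-- An inner-product preserving linear map of a pre-Hilbert module into a Hilbert module extends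
to the completion. -/
def extend {Z : HilbertModule.{w} A} (f : E →ₗ[ℂ] Z)
    (hf : ∀ x y, HilbertModule.ip (f x) (f y) = P.ip x y) : IPMap P.completion Z :=
  { toLinearMap := (f.extendOfNorm P.toCompletion).toLinearMap
    ip_map' := fun x y => by
      have h : ∃ C, ∀ x, ‖f x‖ ≤ C * ‖P.toCompletion x‖ :=
        ⟨1, fun x => by rw [one_mul, norm_toCompletion, HilbertModule.norm_eq, hf]⟩
      have hc := (f.extendOfNorm P.toCompletion).continuous
      change HilbertModule.ip (f.extendOfNorm P.toCompletion x)
        (f.extendOfNorm P.toCompletion y) = _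
      refine P.denseRange_toCompletion.induction_on₂ (p := fun x y =>
        HilbertModule.ip (f.extendOfNorm P.toCompletion x)
          (f.extendOfNorm P.toCompletion y) = HilbertModule.ip x y)
        (isClosed_eq (continuous_ip.comp (hc.prodMap hc)) continuous_ip) (fun a b => ?_) x y
      rw [LinearMap.extendOfNorm_eq P.denseRange_toCompletion h,
        LinearMap.extendOfNorm_eq P.denseRange_toCompletion h, hf, ip_toCompletion] }

lemma extend_toCompletion {Z : HilbertModule.{w} A} (f : E →ₗ[ℂ] Z)
    (hf : ∀ x y, HilbertModule.ip (f x) (f y) = P.ip x y) (x : E) :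
    P.extend f hf (P.toCompletion x) = f x :=
  LinearMap.extendOfNorm_eq P.denseRange_toCompletion
    ⟨1, fun x => by rw [one_mul, norm_toCompletion, HilbertModule.norm_eq, hf]⟩ x

end PreHilbert

end completion

/-! ### Correspondences and internal tensor products -/

section tensor

variable {A : Type v} [NonUnitalCStarAlgebra A] [PartialOrder A] [StarOrderedRing A]

/-- A correspondence over `A`: a right Hilbert `A`-module with a left action of `A` by adjointable
operators, given by a `*`-homomorphism. -/
structure Correspondence (A : Type v) [NonUnitalCStarAlgebra A] [PartialOrder A]
    [StarOrderedRing A] extends HilbertModule.{u} A where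
  lact : A →ₙₐ[ℂ] (carrier →L[ℂ] carrier)
  lact_star : ∀ (a : A) (m n : toHilbertModule), ip (lact a m) n = ip m (lact (star a) n)

lemma exists_posPart_negPart {B : Type*} [NonUnitalCStarAlgebra B] [PartialOrder B]
    [StarOrderedRing B] {b : B} (hb : IsSelfAdjoint b) :
    ∃ p n : B, 0 ≤ p ∧ 0 ≤ n ∧ n * p = 0 ∧ b = p - n :=
  ⟨b⁺, b⁻, CFC.posPart_nonneg b, CFC.negPart_nonneg b, CFC.negPart_mul_posPart b,
    (CFC.posPart_sub_negPart b hb).symm⟩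

lemma exists_eq_star_mul_self {B : Type*} [NonUnitalCStarAlgebra B] [PartialOrder B]
    [StarOrderedRing B] {b : B} (hb : 0 ≤ b) : ∃ c : B, b = star c * c :=
  CStarAlgebra.nonneg_iff_eq_star_mul_self.mp hb

/-- A Gram matrix is of the form `B* B`. -/
lemma exists_gram_eq {X : HilbertModule.{u} A} {ι : Type*} [Fintype ι] (x : ι → X) :
    ∃ B : ι → ι → A, ∀ i j, ip (x i) (x j) = ∑ k, star (B k i) * B k j := by
  classical
  let G : CStarMatrix ι ι A := CStarMatrix.ofMatrix fun i j => ip (x i) (x j)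
  have hG : IsSelfAdjoint G := by
    ext i j
    exact star_ip (x j) (x i)
  obtain ⟨P, N, hP0, hN0, hNP, hGPN⟩ := exists_posPart_negPart hG
  have hN : star N = N := IsSelfAdjoint.of_nonneg hN0
  obtain ⟨C, hC⟩ := exists_eq_star_mul_self hN0
  have h1 : N * G * N + star (C * N) * (C * N) = 0 := by
    have e1 : N * G * N = -(N * N * N) := by
      rw [hGPN, mul_sub, hNP, zero_sub, neg_mul]
    have e2 : star (C * N) * (C * N) = N * N * N := by
      rw [star_mul, hN, mul_assoc, ← mul_assoc (star C), ← hC, mul_assoc]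
    rw [e1, e2, neg_add_cancel]
  set D := C * N with hD
  have h2 : ∀ k, ∑ l, star (D l k) * D l k = 0 := by
    intro k
    have h3 : (N * G * N) k k = ip (∑ i, op (N i k) • x i) (∑ i, op (N i k) • x i) := by
      have hs : ∀ i, N k i = star (N i k) := fun i => by
        conv_lhs => rw [← hN]
        rfl
      simp only [CStarMatrix.mul_apply, ip_sum_left, ip_sum_right, ip_act_left, ip_act_right,
        Finset.sum_mul, hs, mul_assoc]
      rfl
    have h4 : (N * G * N) k k + ∑ l, star (D l k) * D l k = 0 := by
      have := congrArg (fun Q : CStarMatrix ι ι A => Q k k) h1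
      exact this
    have h5 : 0 ≤ ∑ l, star (D l k) * D l k := Finset.sum_nonneg fun l _ => star_mul_self_nonneg _
    have h6 : 0 ≤ (N * G * N) k k := by rw [h3]; exact ip_self_nonneg _
    refine le_antisymm ?_ h5
    rw [← h4]; exact le_add_of_nonneg_left h6
  have h7 : D = 0 := by
    ext l k
    have := (Finset.sum_eq_zero_iff_of_nonneg
      (fun l _ => star_mul_self_nonneg (D l k))).mp (h2 k) l (Finset.mem_univ l)
    exact (CStarRing.star_mul_self_eq_zero_iff _).mp this
  have h8 : N = 0 := by
    have a1 : star (N * N) * (N * N) = 0 := by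
      have : N * N = star C * D := by rw [hD, ← mul_assoc, ← hC]
      rw [this, h7]; simp
    have a2 := (CStarRing.star_mul_self_eq_zero_iff _).mp a1
    refine (CStarRing.star_mul_self_eq_zero_iff _).mp ?_
    rw [hN]; exact a2
  obtain ⟨B, hB⟩ := exists_eq_star_mul_self hP0
  refine ⟨fun k i => B k i, fun i j => ?_⟩
  have : G i j = (star B * B) i j := by rw [hGPN, h8, sub_zero, ← hB]
  exact this

namespace Correspondence

variable (X : HilbertModule.{u} A) (M : Correspondence.{w} A)

lemma ip_lact (a : A) (m n : M.toHilbertModule) :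
    ip m (M.lact a n) = ip (M.lact (star a) m) n := by
  rw [M.lact_star, star_star]

/-- The inner product `⟨x ⊗ m, y ⊗ n⟩ = ⟨m, ⟨x, y⟩ · n⟩` on the algebraic tensor product. -/
def tensorForm : (X ⊗[ℂ] M.toHilbertModule) →ₗ⋆[ℂ] (X ⊗[ℂ] M.toHilbertModule) →ₗ[ℂ] A :=
  TensorProduct.lift (LinearMap.mk₂'ₛₗ (starRingEnd ℂ) (starRingEnd ℂ)
    (fun (x : X) (m : M.toHilbertModule) => TensorProduct.lift (LinearMap.mk₂ ℂ
      (fun (y : X) (n : M.toHilbertModule) => ip m (M.lact (ip x y) n))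
      (fun y y' n => by simp [ip_add_right])
      (fun c y n => by simp [ip_smul_right])
      (fun y n n' => by simp [ip_add_right])
      (fun c y n => by simp [ip_smul_right])))
    (fun x x' m => by
      ext y n; simp [ip_add_right, ip_add_left])
    (fun c x m => by
      ext y n; simp [ip_smul_right, ip_smul_left])
    (fun x m m' => by
      ext y n; simp [ip_add_left])
    (fun c x m => by
      ext y n; simp [ip_smul_left]))

lemma tensorForm_tmul (x y : X) (m n : M.toHilbertModule) :
    tensorForm X M (x ⊗ₜ m) (y ⊗ₜ n) = ip m (M.lact (ip x y) n) := rfl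

/-- The right action of `a : A` on a Hilbert module, as a linear map. -/
def actₗ (X : HilbertModule.{u} A) (a : A) : X →ₗ[ℂ] X where
  toFun x := op a • x
  map_add' x y := by
    rw [← sub_eq_zero, ← ip_self_eq_zero]
    simp only [ip_sub_left, ip_sub_right, ip_add_left, ip_add_right, ip_act_left, ip_act_right,
      mul_add, add_mul]
    abel
  map_smul' c x := by
    rw [← sub_eq_zero, ← ip_self_eq_zero]
    simp only [ip_sub_left, ip_sub_right, ip_smul_left, ip_smul_right, ip_act_left, ip_act_right,
      RingHom.id_apply, smul_mul_assoc, mul_smul_comm]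
    abel

/-- The algebraic tensor product as a pre-Hilbert module. -/
def preTensor : PreHilbert A (X ⊗[ℂ] M.toHilbertModule) where
  ip s t := tensorForm X M s t
  act a := TensorProduct.map LinearMap.id (actₗ M.toHilbertModule a)
  ip_add_right s t t' := map_add _ _ _
  ip_smul_right c s t := map_smul _ _ _
  star_ip s t := by
    induction s with
    | zero => simp
    | add s s' hs hs' => simp [hs, hs']
    | tmul x m =>
      induction t with
      | zero => simp
      | add s s' hs hs' => simp [hs, hs']
      | tmul y n =>
        rw [tensorForm_tmul, tensorForm_tmul, HilbertModule.star_ip, M.lact_star,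
          HilbertModule.star_ip]
  ip_act_right s t a := by
    induction s with
    | zero => simp
    | add s s' hs hs' => simp [hs, hs', add_mul]
    | tmul x m =>
      induction t with
      | zero => simp
      | add s s' hs hs' => simp only [map_add, hs, hs', add_mul]
      | tmul y n =>
        rw [TensorProduct.map_tmul, LinearMap.id_apply, tensorForm_tmul, tensorForm_tmul,
          ip_lact, ip_lact]
        exact ip_act_right _ _ _
  ip_self_nonneg t := by
    obtain ⟨S, rfl⟩ := TensorProduct.exists_finset t
    obtain ⟨B, hB⟩ := exists_gram_eq (fun i : S => i.1.1)
    have : tensorForm X M (∑ i ∈ S, i.1 ⊗ₜ i.2) (∑ i ∈ S, i.1 ⊗ₜ i.2) =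
        ∑ k : S, ip (∑ i : S, M.lact (B k i) i.1.2) (∑ i : S, M.lact (B k i) i.1.2) := by
      rw [← Finset.sum_coe_sort S]
      simp only [map_sum, LinearMap.sum_apply, tensorForm_tmul, hB, ip_sum_left, ip_sum_right,
        M.lact_star, ← mul_apply_eq_comp, ← map_mul, sum_apply]
      symm
      rw [Finset.sum_comm]
      exact Finset.sum_congr rfl fun i _ => Finset.sum_comm
    rw [this]
    exact Finset.sum_nonneg fun k _ => HilbertModule.ip_self_nonneg _

end Correspondence

open Correspondence

/-- The internal tensor product `X ⊗_A M`. -/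
def HilbertModule.tensor (X : HilbertModule.{u} A) (M : Correspondence.{u} A) :
    HilbertModule.{u} A :=
  (preTensor X M).completion

/-- The elementary tensor `x ⊗ m` in `X ⊗_A M`. -/
def HilbertModule.tmul {X : HilbertModule.{u} A} {M : Correspondence.{u} A} (x : X)
    (m : M.toHilbertModule) : X.tensor M :=
  (preTensor X M).toCompletion (x ⊗ₜ m)

/-- `f ⊗ id : X ⊗_A M → X' ⊗_A M`. -/
def IPMap.tensor {X X' : HilbertModule.{u} A} (f : IPMap X X') (M : Correspondence.{u} A) :
    IPMap (X.tensor M) (X'.tensor M) :=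
  (preTensor X M).extend (Z := (preTensor X' M).completion)
    ((preTensor X' M).toCompletion ∘ₗ TensorProduct.map f.toLinearMap LinearMap.id) (fun s t => by
      rw [LinearMap.comp_apply, LinearMap.comp_apply, PreHilbert.ip_toCompletion]
      change tensorForm X' M _ _ = tensorForm X M _ _
      induction s with
      | zero => simp
      | add s s' hs hs' => simp [hs, hs']
      | tmul x m =>
        induction t with
        | zero => simp
        | add s s' hs hs' => simp only [map_add, hs, hs']
        | tmul y n =>
          rw [TensorProduct.map_tmul, TensorProduct.map_tmul, tensorForm_tmul, tensorForm_tmul]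
          exact congrArg (fun a => ip m (M.lact a n)) (f.ip_map x y))

lemma IPMap.tensor_tmul {X X' : HilbertModule.{u} A} (f : IPMap X X') (M : Correspondence.{u} A)
    (x : X) (m : M.toHilbertModule) : f.tensor M (tmul x m) = tmul (f x) m :=
  PreHilbert.extend_toCompletion _ _ _ _

/-- `X ⊗_A M^{⊗ k}`, with tensor powers bracketed from the left:
`((X ⊗_A M) ⊗_A M) ⊗_A ⋯ ⊗_A M`. -/
def HilbertModule.tensorPow (X : HilbertModule.{u} A) (M : Correspondence.{u} A) :
    ℕ → HilbertModule.{u} A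
  | 0 => X
  | k + 1 => (X.tensorPow M k).tensor M

/-- `f ⊗ id_k : X ⊗_A M^{⊗ k} → X' ⊗_A M^{⊗ k}`. -/
def IPMap.tensorPow {X X' : HilbertModule.{u} A} (f : IPMap X X') (M : Correspondence.{u} A) :
    ∀ k, IPMap (X.tensorPow M k) (X'.tensorPow M k)
  | 0 => f
  | k + 1 => (f.tensorPow M k).tensor M

/-- For `f : X → X' ⊗_A M`, the map
`f ⊗ id_k : X ⊗_A M^{⊗ k} → (X' ⊗_A M) ⊗_A M^{⊗ k} = X' ⊗_A M^{⊗ (k + 1)}`. -/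
def IPMap.tensorStep {X X' : HilbertModule.{u} A} {M : Correspondence.{u} A}
    (f : IPMap X (X'.tensor M)) : ∀ k, IPMap (X.tensorPow M k) (X'.tensorPow M (k + 1))
  | 0 => f
  | k + 1 => (f.tensorStep k).tensor M

/-- For `U : X → X ⊗_A M`, the map `U^k : X → X ⊗_A M^{⊗ k}` with `U^0 = id` and
`U^{k+1} = (U ⊗ id_k) ∘ U^k`. -/
def IPMap.iterate {X : HilbertModule.{u} A} {M : Correspondence.{u} A}
    (U : IPMap X (X.tensor M)) : ∀ k, IPMap X (X.tensorPow M k)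
  | 0 => IPMap.id X
  | k + 1 => (U.tensorStep k).comp (U.iterate k)

end tensor

/-! ### Direct limits -/

section limit

variable {A : Type v} [NonUnitalCStarAlgebra A] [PartialOrder A] [StarOrderedRing A]

namespace HilbertLimit

variable (X : ℕ → HilbertModule.{u} A) (T : ∀ k, IPMap (X k) (X (k + 1)))

/-- The algebraic direct limit is realised by the sequences `(x_k)` with `x_{k+1} = T_k x_k` for
all large `k`; two such sequences define the same element if they agree for all large `k`, and
this identification is made when vectors of length zero are divided out below. -/
def seqs : Submodule ℂ (∀ k, X k) where
  carrier := {x | ∃ N, ∀ k ≥ N, x (k + 1) = T k (x k)}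
  add_mem' := by
    rintro x y ⟨N, hN⟩ ⟨N', hN'⟩
    refine ⟨max N N', fun k hk => ?_⟩
    rw [Pi.add_apply, Pi.add_apply, map_add, hN k (le_of_max_le_left hk),
      hN' k (le_of_max_le_right hk)]
  zero_mem' := ⟨0, fun k _ => (map_zero _).symm⟩
  smul_mem' := by
    rintro c x ⟨N, hN⟩
    exact ⟨N, fun k hk => by rw [Pi.smul_apply, Pi.smul_apply, map_smul, hN k hk]⟩

/-- The eventually constant value of `⟨x_k, y_k⟩`. -/
def seqIp (x y : seqs X T) : A := Filter.atTop.limUnder fun k => ip (x.1 k) (y.1 k)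

lemma eventually_seqIp (x y : seqs X T) :
    ∀ᶠ k in Filter.atTop, seqIp X T x y = ip (x.1 k) (y.1 k) := by
  obtain ⟨N, hN⟩ := x.2
  obtain ⟨N', hN'⟩ := y.2
  have h : ∀ k ≥ max N N', ip (x.1 k) (y.1 k) =
      ip (x.1 (max N N')) (y.1 (max N N')) := by
    intro k hk
    induction k, hk using Nat.le_induction with
    | base => rfl
    | succ k hk ih =>
      rw [hN k (le_of_max_le_left hk), hN' k (le_of_max_le_right hk), IPMap.ip_map, ih]
  have h2 : seqIp X T x y = ip (x.1 (max N N')) (y.1 (max N N')) :=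
    (tendsto_const_nhds.congr' (Filter.eventually_atTop.mpr
      ⟨max N N', fun k hk => (h k hk).symm⟩)).limUnder_eq
  exact Filter.eventually_atTop.mpr ⟨max N N', fun k hk => h2.trans (h k hk).symm⟩

/-- The algebraic direct limit as a pre-Hilbert module. -/
def pre : PreHilbert A (seqs X T) where
  ip := seqIp X T
  act a :=
    { toFun := fun x => ⟨fun k => op a • x.1 k, by
        obtain ⟨N, hN⟩ := x.2
        exact ⟨N, fun k hk => by beta_reduce; rw [hN k hk, IPMap.map_act]⟩⟩
      map_add' := fun x y => Subtype.ext <| funext fun k =>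
        (Correspondence.actₗ (X k) a).map_add _ _
      map_smul' := fun c x => Subtype.ext <| funext fun k =>
        (Correspondence.actₗ (X k) a).map_smul _ _ }
  ip_add_right x y z := by
    obtain ⟨k, h1, h2, h3⟩ := ((eventually_seqIp X T x (y + z)).and
      ((eventually_seqIp X T x y).and (eventually_seqIp X T x z))).exists
    rw [h1, h2, h3]; exact ip_add_right _ _ _
  ip_smul_right c x y := by
    obtain ⟨k, h1, h2⟩ := ((eventually_seqIp X T x (c • y)).and
      (eventually_seqIp X T x y)).exists
    rw [h1, h2]; exact ip_smul_right _ _ _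
  star_ip x y := by
    obtain ⟨k, h1, h2⟩ := ((eventually_seqIp X T x y).and (eventually_seqIp X T y x)).exists
    rw [h1, h2]; exact star_ip _ _
  ip_act_right x y a := by
    obtain ⟨k, h1, h2⟩ := ((eventually_seqIp X T x _).and (eventually_seqIp X T x y)).exists
    rw [h1, h2]; exact ip_act_right _ _ _
  ip_self_nonneg x := by
    obtain ⟨k, h⟩ := (eventually_seqIp X T x x).exists
    rw [h]; exact ip_self_nonneg _

/-- The maps `T_{k-1} ∘ ⋯ ∘ T_j : X_j → X_k` for `j ≤ k`. -/
def transition {j k : ℕ} (h : j ≤ k) : IPMap (X j) (X k) :=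
  Nat.leRecOn (C := fun n => IPMap (X j) (X n)) h (fun {n} f => (T n).comp f) (IPMap.id (X j))

lemma transition_succ {j k : ℕ} (h : j ≤ k) (x : X j) :
    transition X T (Nat.le_succ_of_le h) x = T k (transition X T h x) := by
  unfold transition
  rw [Nat.leRecOn_succ h]; rfl

/-- The class of `x : X k` in the algebraic direct limit. -/
def toSeqs (k : ℕ) : X k →ₗ[ℂ] seqs X T where
  toFun x := ⟨fun j => if h : k ≤ j then transition X T h x else 0, k, fun j hj => by
    beta_reduce
    rw [dif_pos hj, dif_pos (show k ≤ j + 1 from Nat.le_succ_of_le hj), transition_succ]⟩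
  map_add' x y := by
    ext j
    by_cases h : k ≤ j <;> simp [h]
  map_smul' c x := by
    ext j
    by_cases h : k ≤ j <;> simp [h]

end HilbertLimit

/-- The direct limit of a sequence of Hilbert modules and inner-product preserving maps: the
completion of the algebraic direct limit. -/
def directLimit (X : ℕ → HilbertModule.{u} A) (T : ∀ k, IPMap (X k) (X (k + 1))) :
    HilbertModule.{u} A :=
  (HilbertLimit.pre X T).completion

/-- The canonical maps `ι^k : X_k → X_∞`. -/
def directLimit.ι (X : ℕ → HilbertModule.{u} A) (T : ∀ k, IPMap (X k) (X (k + 1))) (k : ℕ) :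
    IPMap (X k) (directLimit X T) where
  toLinearMap := (HilbertLimit.pre X T).toCompletion ∘ₗ HilbertLimit.toSeqs X T k
  ip_map' x y := by
    refine ((HilbertLimit.pre X T).ip_toCompletion _ _).trans ?_
    obtain ⟨j, h1, h2⟩ := ((HilbertLimit.eventually_seqIp X T (HilbertLimit.toSeqs X T k x)
      (HilbertLimit.toSeqs X T k y)).and (Filter.eventually_ge_atTop k)).exists
    refine h1.trans ?_
    simp only [HilbertLimit.toSeqs, LinearMap.coe_mk, AddHom.coe_mk, dif_pos h2, IPMap.ip_map]

end limit

/-! ### Direct sums -/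

section directSum

variable {A : Type v} [NonUnitalCStarAlgebra A] [PartialOrder A] [StarOrderedRing A]

/-- A complete pre-Hilbert module with a definite inner product is a Hilbert module. -/
def PreHilbert.toHilbertModule {E : Type u} [AddCommGroup E] [Module ℂ E] (P : PreHilbert A E)
    (hdef : ∀ x, P.ip x x = 0 → x = 0) (hc : CompleteSpace P.Space) : HilbertModule.{u} A :=
  letI : NormedAddCommGroup P.Space := NormedAddCommGroup.ofSeparation fun x hx =>
    hdef x (by rwa [P.norm_def, Real.sqrt_eq_zero (norm_nonneg _), norm_eq_zero] at hx)
  ofIp P.Space P.ip (fun a => P.act a) P.ip_add_right P.ip_smul_right P.star_ip P.ip_act_right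
    P.ip_self_nonneg (fun _ => rfl)

namespace HilbertSum

variable {ι : Type} (W : ι → HilbertModule.{u} A)

/-- The inner product of the components in a finite set. -/
def finPre (s : Finset ι) : PreHilbert A (∀ i, W i) where
  ip x y := ∑ i ∈ s, ip (x i) (y i)
  act a := LinearMap.pi fun i => (Correspondence.actₗ (W i) a) ∘ₗ LinearMap.proj i
  ip_add_right x y z := by simp [ip_add_right, Finset.sum_add_distrib]
  ip_smul_right c x y := by simp [ip_smul_right, Finset.smul_sum]
  star_ip x y := by simp [star_ip]
  ip_act_right x y a := by
    rw [Finset.sum_mul]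
    exact Finset.sum_congr rfl fun i _ => ip_act_right _ _ _
  ip_self_nonneg x := Finset.sum_nonneg fun i _ => ip_self_nonneg _

lemma summable_ip {x y : ∀ i, W i} (hx : Summable fun i => ip (x i) (x i))
    (hy : Summable fun i => ip (y i) (y i)) : Summable fun i => ip (x i) (y i) := by
  classical
  rw [summable_iff_vanishing_norm] at *
  intro ε hε
  obtain ⟨s, hs⟩ := hx ε hε
  obtain ⟨s', hs'⟩ := hy ε hε
  refine ⟨s ∪ s', fun t ht => ?_⟩
  rw [Finset.disjoint_union_right] at ht
  have h1 := hs t ht.1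
  have h2 := hs' t ht.2
  have h3 : ‖∑ i ∈ t, ip (x i) (y i)‖ ≤
      √‖∑ i ∈ t, ip (x i) (x i)‖ * √‖∑ i ∈ t, ip (y i) (y i)‖ := (finPre W t).norm_ip_le x y
  refine h3.trans_lt ?_
  calc √‖∑ i ∈ t, ip (x i) (x i)‖ * √‖∑ i ∈ t, ip (y i) (y i)‖ < √ε * √ε := by
        have := Real.sqrt_lt_sqrt (norm_nonneg _) h1
        have := Real.sqrt_lt_sqrt (norm_nonneg _) h2
        exact mul_lt_mul'' ‹_› ‹_› (Real.sqrt_nonneg _) (Real.sqrt_nonneg _)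
    _ = ε := Real.mul_self_sqrt hε.le

/-- The families `(x_i)` for which `∑ ⟨x_i, x_i⟩` converges in `A`. -/
def families : Submodule ℂ (∀ i, W i) where
  carrier := {x | Summable fun i => ip (x i) (x i)}
  add_mem' := fun {x y} hx hy => by
    have := ((hx.add (summable_ip W hx hy)).add (summable_ip W hy hx)).add hy
    refine this.congr fun i => ?_
    simp only [Pi.add_apply, ip_add_left, ip_add_right]
    abel
  zero_mem' := by
    refine summable_zero.congr fun i => ?_
    exact (ip_self_eq_zero.mpr rfl).symm
  smul_mem' := fun c x hx => by
    refine ((Summable.const_smul c hx).const_smul (star c)).congr fun i => ?_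
    simp only [Pi.smul_apply, ip_smul_left, ip_smul_right, smul_comm c]

/-- The inner product `⟨x, y⟩ = ∑ ⟨x_i, y_i⟩`. -/
def pre : PreHilbert A (families W) where
  ip x y := ∑' i, ip (x.1 i) (y.1 i)
  act a := ((finPre W ∅).act a ∘ₗ (families W).subtype).codRestrict (families W) fun x => by
    refine ((x.2.mul_right a).mul_left (star a)).congr fun i => ?_
    exact ((ip_act_left _ _ _).trans (congrArg _ (ip_act_right _ _ _))).symm
  ip_add_right x y z := by
    rw [← (summable_ip W x.2 y.2).tsum_add (summable_ip W x.2 z.2)]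
    exact tsum_congr fun i => ip_add_right _ _ _
  ip_smul_right c x y := by
    rw [← (summable_ip W x.2 y.2).tsum_const_smul c]
    exact tsum_congr fun i => ip_smul_right _ _ _
  star_ip x y := by
    refine (tsum_star (f := fun i => ip (x.1 i) (y.1 i))).trans ?_
    exact tsum_congr fun i => star_ip _ _
  ip_act_right x y a := by
    rw [← (summable_ip W x.2 y.2).tsum_mul_right a]
    exact tsum_congr fun i => ip_act_right _ _ _
  ip_self_nonneg x := by
    refine (CStarAlgebra.isClosed_nonneg (A := A)).mem_of_tendsto x.2.hasSum
      (Filter.Eventually.of_forall fun s => ?_)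
    exact Finset.sum_nonneg fun i _ => ip_self_nonneg _

lemma fin_norm_le (x : families W) (t : Finset ι) :
    ‖∑ i ∈ t, ip (x.1 i) (x.1 i)‖ ≤ ‖(pre W).ip x x‖ := by
  refine ge_of_tendsto x.2.hasSum.norm (Filter.eventually_atTop.mpr ⟨t, fun s hs => ?_⟩)
  exact CStarAlgebra.norm_le_norm_of_nonneg_of_le (Finset.sum_nonneg fun i _ => ip_self_nonneg _)
    (Finset.sum_le_sum_of_subset_of_nonneg hs fun i _ _ => ip_self_nonneg _)

lemma norm_apply_le (x : families W) (i : ι) : ‖x.1 i‖ ≤ √‖(pre W).ip x x‖ := by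
  rw [norm_eq]
  refine Real.sqrt_le_sqrt ?_
  simpa using fin_norm_le W x {i}

lemma definite (x : families W) (h : (pre W).ip x x = 0) : x = 0 := by
  ext i
  have := norm_apply_le W x i
  rw [h, norm_zero, Real.sqrt_zero] at this
  exact norm_le_zero_iff.mp this

lemma complete : CompleteSpace (pre W).Space := by
  classical
  refine Metric.complete_of_cauchySeq_tendsto fun u hu => ?_
  let c : ℕ → families W := u
  have hdist : ∀ m n, dist (u m) (u n) = √‖(pre W).ip (c m - c n) (c m - c n)‖ := fun m n => by
    rw [dist_eq_norm]; rfl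
  have hcomp : ∀ i, ∃ z : W i, Filter.Tendsto (fun n => (c n).1 i) Filter.atTop (nhds z) := by
    intro i
    refine cauchySeq_tendsto_of_complete ?_
    rw [Metric.cauchySeq_iff] at hu ⊢
    intro ε hε
    obtain ⟨N, hN⟩ := hu ε hε
    refine ⟨N, fun m hm n hn => lt_of_le_of_lt ?_ (hN m hm n hn)⟩
    rw [hdist, dist_eq_norm]
    exact norm_apply_le W (c m - c n) i
  choose z hz using hcomp
  have key : ∀ ε > 0, ∃ N, ∀ n ≥ N, ∀ t : Finset ι,
      √‖(finPre W t).ip (z - (c n).1) (z - (c n).1)‖ ≤ ε := by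
    intro ε hε
    obtain ⟨N, hN⟩ := Metric.cauchySeq_iff.mp hu ε hε
    refine ⟨N, fun n hn t => ?_⟩
    have hlim : Filter.Tendsto
        (fun m => √‖∑ i ∈ t, ip ((c m).1 i - (c n).1 i) ((c m).1 i - (c n).1 i)‖) Filter.atTop
        (nhds √‖∑ i ∈ t, ip (z i - (c n).1 i) (z i - (c n).1 i)‖) := by
      refine (tendsto_finsetSum t fun i _ => ?_).norm.sqrt
      have := (hz i).sub_const ((c n).1 i)
      exact (continuous_ip.tendsto _).comp (this.prodMk_nhds this)
    refine le_of_tendsto hlim (Filter.eventually_atTop.mpr ⟨N, fun m hm => ?_⟩)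
    have h1 := hN m hm n hn
    rw [hdist] at h1
    exact (Real.sqrt_le_sqrt (fin_norm_le W (c m - c n) t)).trans h1.le
  have hzmem : z ∈ families W := by
    change Summable fun i => ip (z i) (z i)
    rw [summable_iff_vanishing_norm]
    intro ε hε
    obtain ⟨N, hN⟩ := key (√ε / 3) (by positivity)
    have hs := (c N).2
    change Summable fun i => ip ((c N).1 i) ((c N).1 i) at hs
    rw [summable_iff_vanishing_norm] at hs
    obtain ⟨s, hs⟩ := hs ((√ε / 3) ^ 2) (by positivity)
    refine ⟨s, fun t ht => ?_⟩
    have h1 := hN N le_rfl t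
    have h2 : √‖(finPre W t).ip (c N).1 (c N).1‖ ≤ √ε / 3 := by
      rw [Real.sqrt_le_left (by positivity)]
      exact (hs t ht).le
    have h3 := (finPre W t).triangle (z - (c N).1) (c N).1
    rw [sub_add_cancel] at h3
    have h4 : √‖(finPre W t).ip z z‖ < √ε := by
      have : 0 < √ε := Real.sqrt_pos.mpr hε
      linarith
    exact (Real.sqrt_lt_sqrt_iff (norm_nonneg _)).mp h4
  let zz : families W := ⟨z, hzmem⟩
  refine ⟨(zz : (pre W).Space), Metric.tendsto_atTop.mpr fun ε hε => ?_⟩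
  obtain ⟨N, hN⟩ := key (ε / 2) (by positivity)
  refine ⟨N, fun n hn => ?_⟩
  have h1 : dist (u n) (zz : (pre W).Space) = √‖(pre W).ip (zz - c n) (zz - c n)‖ := by
    refine (dist_comm _ _).trans ((dist_eq_norm (E := (pre W).Space) _ _).trans rfl)
  rw [h1]
  refine lt_of_le_of_lt ?_ (half_lt_self hε)
  refine le_of_tendsto (zz - c n).2.hasSum.norm.sqrt (Filter.Eventually.of_forall fun t => ?_)
  exact hN n hn t

end HilbertSum

/-- The Hilbert-module direct sum `⨁ W_i`: all families `(x_i)` with `∑ ⟨x_i, x_i⟩` convergent in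
`A`, with the inner product `∑ ⟨x_i, y_i⟩`. -/
def hilbertSum {ι : Type} (W : ι → HilbertModule.{u} A) : HilbertModule.{u} A :=
  (HilbertSum.pre W).toHilbertModule (HilbertSum.definite W) (HilbertSum.complete W)

/-- The components of an element of the direct sum. -/
def hilbertSum.component {ι : Type} {W : ι → HilbertModule.{u} A} (x : hilbertSum W) (i : ι) :
    W i :=
  (show HilbertSum.families W from x).1 i

end directSum

/-! ### The multi-resolution analysis -/

section mra

variable {A : Type v} [NonUnitalCStarAlgebra A] [PartialOrder A] [StarOrderedRing A]
  {M : Correspondence.{u} A} {Y : HilbertModule.{u} A}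

namespace MRA

/-- `Y_∞ = lim (Y ⊗_A M^{⊗ k}, T_k)` with `T_k = T ⊗ id_k`. -/
def limit (T : IPMap Y (Y.tensor M)) : HilbertModule.{u} A :=
  directLimit (fun k => Y.tensorPow M k) T.tensorStep

/-- `ι^k : Y ⊗_A M^{⊗ k} → Y_∞`. -/
def ι (T : IPMap Y (Y.tensor M)) (k : ℕ) : IPMap (Y.tensorPow M k) (limit T) :=
  directLimit.ι (fun k => Y.tensorPow M k) T.tensorStep k

/-- `Y_k = ι^k (Y ⊗_A M^{⊗ k})`. -/
def subY (T : IPMap Y (Y.tensor M)) (k : ℕ) : HilbertSubmodule (limit T) :=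
  HilbertSubmodule.range (ι T k)

/-- `Z_k = Y_{k+1} ⊖ Y_k`. -/
def subZ (T : IPMap Y (Y.tensor M)) (k : ℕ) : HilbertSubmodule (limit T) :=
  (subY T (k + 1)).ominus (subY T k)

/-- The summands of `Y_0 ⊕ (⨁_k Z_k)`: `Y_0` at `none` and `Z_k` at `some k`. -/
def summand (T : IPMap Y (Y.tensor M)) : Option ℕ → HilbertSubmodule (limit T)
  | none => subY T 0
  | some k => subZ T k

end MRA

end mra

end

/-!
Since `T` has an adjoint, `T(Y)` is complemented in `Y ⊗ M`. Tensoring with `M` preserves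
orthogonal decompositions, the one analytic point being that the sum of two orthogonal closed
submodules is closed. Hence each `Y_k` is complemented in `Y_{k+1}`, and telescoping yields the
decomposition of `Y_∞`. The map `R^k` carries the pair `Y_k ⊂ Y_{k+1}` to the pair `Y_0 ⊂ Y_1`
tensored with `M^{⊗ k}`. So `R^k(Z_k)` and `Z_0 ⊗ M^{⊗ k}` are both the orthogonal complement of
the same submodule in the same larger one, which makes them equal.
-/

noncomputable section

open HilbertModule

universe u₁ u₂ u₃ u₄

variable {A : Type v} [NonUnitalCStarAlgebra A] [PartialOrder A] [StarOrderedRing A]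

namespace HilbertModule

variable {X : HilbertModule.{u} A}

lemma ip_zero_right (x : X) : ip x (0 : X) = 0 := by
  simpa using ip_smul_right 0 x (0 : X)

lemma ip_eq_zero_comm {x y : X} : ip x y = 0 ↔ ip y x = 0 := by
  rw [← star_ip, star_eq_zero]

end HilbertModule

namespace IPMap

variable {X : HilbertModule.{u} A} {Y : HilbertModule.{u₁} A} {V : HilbertModule.{w} A}

lemma ext {f g : IPMap X V} (h : ∀ x, f x = g x) : f = g := by
  cases f
  cases g
  congr
  exact LinearMap.ext h

lemma continuous (f : IPMap X V) : Continuous f :=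
  f.isometry.continuous

lemma injective (f : IPMap X V) : Function.Injective f :=
  f.isometry.injective

lemma isClosed_range (f : IPMap X V) : IsClosed (f.toLinearMap.range : Set V) :=
  (HilbertSubmodule.range f).isClosed'

lemma exists_iso_of_range_eq {f : IPMap X V} {g : IPMap Y V}
    (h : f.toLinearMap.range = g.toLinearMap.range) :
    ∃ φ : HilbertIso X Y, ∀ x, g (φ x) = f x := by
  let e : X ≃ₗ[ℂ] Y := LinearEquiv.ofInjective f.toLinearMap f.injective ≪≫ₗ
    LinearEquiv.ofEq _ _ h ≪≫ₗ (LinearEquiv.ofInjective g.toLinearMap g.injective).symm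
  have hge : ∀ x, g (e x) = f x := fun x =>
    congrArg Subtype.val ((LinearEquiv.ofInjective g.toLinearMap g.injective).apply_symm_apply _)
  refine ⟨⟨⟨e, fun x y => ?_⟩, e.surjective⟩, hge⟩
  exact (g.ip_map _ _).symm.trans ((congrArg₂ ip (hge x) (hge y)).trans (f.ip_map x y))

end IPMap

lemma HilbertIso.ext {X : HilbertModule.{u} A} {Y : HilbertModule.{w} A} {f g : HilbertIso X Y}
    (h : ∀ x, f x = g x) : f = g := by
  cases f
  cases g
  congr
  exact IPMap.ext h

/-! ### Orthogonal families -/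

namespace HilbertSubmodule

variable {X : HilbertModule.{u} A}

/-- Orthogonality of closed submodules. -/
def IsOrtho (U V : HilbertSubmodule X) : Prop :=
  ∀ x ∈ U, ∀ y ∈ V, ip x y = 0

lemma IsOrtho.symm {U V : HilbertSubmodule X} (h : U.IsOrtho V) : V.IsOrtho U :=
  fun y hy x hx => ip_eq_zero_comm.mp (h x hx y hy)

lemma isOrtho_range {Y : HilbertModule.{u₁} A} {Z : HilbertModule.{u₂} A} {f : IPMap Y X}
    {g : IPMap Z X} (h : ∀ y z, ip (f y) (g z) = 0) : (range f).IsOrtho (range g) := by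
  rintro _ ⟨y, rfl⟩ _ ⟨z, rfl⟩
  exact h y z

lemma range_incl (V : HilbertSubmodule X) : V.incl.toLinearMap.range = V.toSubmodule :=
  V.toSubmodule.range_subtype

end HilbertSubmodule

namespace hilbertSum

variable {ι : Type} {X : HilbertModule.{u} A} {V : ι → HilbertSubmodule X}

lemma summable_ip_component (w : hilbertSum fun i => (V i).toModule) :
    Summable fun i => ip (component w i) (component w i) :=
  (show HilbertSum.families (fun i => (V i).toModule) from w).2

lemma exists_single (i : ι) (v : (V i).toModule) :
    ∃ w : hilbertSum fun i => (V i).toModule,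
      component w i = v ∧ ∀ j, j ≠ i → component w j = 0 := by
  classical
  let x : ∀ j, (V j).toModule := Pi.single i v
  have hx : ∀ j, j ≠ i → x j = 0 := fun j hj =>
    Pi.single_eq_of_ne (M := fun j => (V j).toModule.carrier) hj v
  have hsum : Summable fun j => ip (x j) (x j) :=
    (hasSum_single i fun j hj => ip_self_eq_zero.mpr (hx j hj)).summable
  exact ⟨(⟨x, hsum⟩ : HilbertSum.families fun i => (V i).toModule),
    Pi.single_eq_same (M := fun j => (V j).toModule.carrier) i v, hx⟩

lemma ip_sum_sum (hV : Pairwise fun i j => (V i).IsOrtho (V j)) (s : Finset ι)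
    (x y : ∀ i, (V i).toModule) :
    ip (∑ i ∈ s, (V i).incl (x i)) (∑ i ∈ s, (V i).incl (y i)) = ∑ i ∈ s, ip (x i) (y i) := by
  rw [ip_sum_left]
  refine Finset.sum_congr rfl fun i hi => ?_
  rw [ip_sum_right, Finset.sum_eq_single_of_mem i hi fun j _ hji => ?_]
  · exact (V i).incl.ip_map _ _
  · exact hV hji.symm _ (x i).2 _ (y j).2

lemma summable_incl (hV : Pairwise fun i j => (V i).IsOrtho (V j))
    (w : hilbertSum fun i => (V i).toModule) : Summable fun i => (V i).incl (component w i) := by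
  rw [summable_iff_vanishing_norm]
  intro ε hε
  obtain ⟨s, hs⟩ := summable_iff_vanishing_norm.mp (summable_ip_component w) (ε ^ 2) (by positivity)
  refine ⟨s, fun t ht => ?_⟩
  rw [norm_eq, ip_sum_sum hV, Real.sqrt_lt' hε]
  exact hs t ht

/-- The map `(v_i) ↦ ∑ v_i` from the Hilbert-module direct sum of pairwise orthogonal closed
submodules of `X` to `X`. -/
def sumMap (hV : Pairwise fun i j => (V i).IsOrtho (V j)) :
    IPMap (hilbertSum fun i => (V i).toModule) X where
  toFun w := ∑' i, (V i).incl (component w i)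
  map_add' w w' := by
    rw [← (summable_incl hV w).tsum_add (summable_incl hV w')]
    exact tsum_congr fun i => map_add _ _ _
  map_smul' c w := by
    rw [RingHom.id_apply, ← (summable_incl hV w).tsum_const_smul c]
    exact tsum_congr fun i => (V i).incl.toLinearMap.map_smul c (component w i)
  ip_map' w w' := by
    have hip := (continuous_ip.tendsto _).comp
      ((summable_incl hV w).hasSum.prodMk_nhds (summable_incl hV w').hasSum)
    simp only [Function.comp_def, ip_sum_sum hV] at hip
    exact tendsto_nhds_unique hip (HilbertSum.summable_ip _ (summable_ip_component w)
      (summable_ip_component w')).hasSum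

variable (hV : Pairwise fun i j => (V i).IsOrtho (V j))

lemma hasSum_sumMap (w : hilbertSum fun i => (V i).toModule) :
    HasSum (fun i => (V i).incl (component w i)) (sumMap hV w) :=
  (summable_incl hV w).hasSum

lemma le_range_sumMap (i : ι) : (V i).toSubmodule ≤ (sumMap hV).toLinearMap.range := by
  intro x hx
  obtain ⟨w, hwi, hw⟩ := exists_single (V := V) i ⟨x, hx⟩
  refine ⟨w, (hasSum_sumMap hV w).unique ?_⟩
  have hsum : HasSum (fun j => (V j).incl (component w j)) ((V i).incl (component w i)) :=
    hasSum_single i fun j hj => by rw [hw j hj, map_zero]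
  rwa [hwi] at hsum

lemma range_sumMap [Finite ι] : (sumMap hV).toLinearMap.range = ⨆ i, (V i).toSubmodule := by
  have := Fintype.ofFinite ι
  refine le_antisymm ?_ (iSup_le (le_range_sumMap hV))
  rintro _ ⟨w, rfl⟩
  rw [(hasSum_sumMap hV w).unique (hasSum_fintype _)]
  exact sum_mem fun i _ => Submodule.mem_iSup_of_mem i (component w i).2

end hilbertSum

lemma HilbertSubmodule.IsOrtho.isClosed_sup {X : HilbertModule.{u} A} {U V : HilbertSubmodule X}
    (h : U.IsOrtho V) : IsClosed (U.toSubmodule ⊔ V.toSubmodule : Submodule ℂ X).carrier := by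
  let F : Bool → HilbertSubmodule X := fun b => cond b U V
  have hF : Pairwise fun i j => (F i).IsOrtho (F j) := by
    rintro (_ | _) (_ | _) hij
    exacts [absurd rfl hij, h.symm, h, absurd rfl hij]
  have hsup : (⨆ b, (F b).toSubmodule) = U.toSubmodule ⊔ V.toSubmodule := iSup_bool_eq
  rw [← hsup, ← hilbertSum.range_sumMap hF]
  exact (hilbertSum.sumMap hF).isClosed_range

lemma hasSum_some_of_hasSum_option {α E : Type*} [AddCommGroup E] [TopologicalSpace E]
    [IsTopologicalAddGroup E] {f : Option α → E} {s : E} (h : HasSum f s) :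
    HasSum (fun a => f (some a)) (s - f none) := by
  classical
  have hite := hasSum_ite_sub_hasSum h none
  rw [← (Option.some_injective α).hasSum_iff fun o ho => ?_] at hite
  · simpa only [Function.comp_def, reduceCtorEq, if_false] using hite
  · rw [if_pos (by simpa [Option.eq_none_iff_forall_some_ne] using ho)]

/-! ### Orthogonal sums of ranges -/

/-- The range of `h` is the orthogonal sum of the ranges of `f` and `g`. Submodules are given by
inner-product preserving maps onto them because tensoring acts on maps. -/
structure IsOrthogonalSum {X : HilbertModule.{u₁} A} {W : HilbertModule.{u₂} A}
    {H : HilbertModule.{u₃} A} {V : HilbertModule.{w} A} (f : IPMap X V) (g : IPMap W V)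
    (h : IPMap H V) : Prop where
  ip_eq_zero : ∀ x w, ip (f x) (g w) = 0
  range_sup_range : f.toLinearMap.range ⊔ g.toLinearMap.range = h.toLinearMap.range

namespace IsOrthogonalSum

variable {X : HilbertModule.{u₁} A} {W : HilbertModule.{u₂} A} {H : HilbertModule.{u₃} A}
  {W' : HilbertModule.{u₄} A} {V V' : HilbertModule.{w} A} {f : IPMap X V} {g : IPMap W V}
  {g' : IPMap W' V} {h : IPMap H V}

lemma comp (hs : IsOrthogonalSum f g h) (u : IPMap V V') :
    IsOrthogonalSum (u.comp f) (u.comp g) (u.comp h) where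
  ip_eq_zero x w := (u.ip_map _ _).trans (hs.ip_eq_zero x w)
  range_sup_range := by
    simp only [IPMap.comp, LinearMap.range_comp, ← Submodule.map_sup, hs.range_sup_range]

lemma mem_range_right_iff (hs : IsOrthogonalSum f g h) {v : V} :
    v ∈ g.toLinearMap.range ↔ v ∈ h.toLinearMap.range ∧ ∀ x, ip (f x) v = 0 := by
  constructor
  · rintro ⟨w, rfl⟩
    exact ⟨hs.range_sup_range.le (Submodule.mem_sup_right ⟨w, rfl⟩), fun x => hs.ip_eq_zero x w⟩
  · rintro ⟨hv, hfv⟩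
    rw [← hs.range_sup_range] at hv
    obtain ⟨_, ⟨x, rfl⟩, _, ⟨w, rfl⟩, rfl⟩ := Submodule.mem_sup.mp hv
    have hfx : f x = 0 := by
      rw [← ip_self_eq_zero, ← hfv x, ip_add_right, hs.ip_eq_zero, add_zero]
    exact ⟨w, by rw [hfx, zero_add]⟩

lemma exists_iso (hs : IsOrthogonalSum f g h) (hs' : IsOrthogonalSum f g' h) :
    ∃ φ : HilbertIso W W', ∀ w, g' (φ w) = g w :=
  IPMap.exists_iso_of_range_eq <| Submodule.ext fun _ =>
    hs.mem_range_right_iff.trans hs'.mem_range_right_iff.symm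

lemma ominus (hs : IsOrthogonalSum f g h) :
    IsOrthogonalSum f ((HilbertSubmodule.range h).ominus (HilbertSubmodule.range f)).incl h where
  ip_eq_zero x z := z.2.2 _ ⟨x, rfl⟩
  range_sup_range := by
    rw [← hs.range_sup_range, HilbertSubmodule.range_incl]
    congr 1
    ext v
    refine Iff.trans ⟨fun hv => ⟨hv.1, fun x => hv.2 _ ⟨x, rfl⟩⟩, fun hv => ⟨hv.1, ?_⟩⟩
      hs.mem_range_right_iff.symm
    rintro _ ⟨x, rfl⟩
    exact hv.2 x

end IsOrthogonalSum

lemma IPMap.IsAdjointable.isOrthogonalSum {X : HilbertModule.{u₁} A} {V : HilbertModule.{w} A}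
    {f : IPMap X V} (hf : f.IsAdjointable) : IsOrthogonalSum f
      ((HilbertSubmodule.range (IPMap.id V)).ominus (HilbertSubmodule.range f)).incl
      (IPMap.id V) where
  ip_eq_zero x z := z.2.2 _ ⟨x, rfl⟩
  range_sup_range := by
    obtain ⟨g, hg⟩ := hf
    rw [HilbertSubmodule.range_incl]
    refine le_antisymm (fun v _ => ⟨v, rfl⟩) fun v _ => Submodule.mem_sup.mpr ?_
    refine ⟨f (g v), ⟨g v, rfl⟩, v - f (g v), ⟨⟨_, rfl⟩, ?_⟩, add_sub_cancel _ _⟩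
    rintro _ ⟨x, rfl⟩
    rw [ip_sub_right, f.ip_map, hg, sub_self]

/-! ### Tensoring maps with a correspondence -/

section tensor

variable {X X' X'' W H V : HilbertModule.{u} A} {M : Correspondence.{u} A}

namespace HilbertModule

lemma ip_tmul (x y : X) (m n : M.toHilbertModule) :
    ip (tmul x m) (tmul y n) = ip m (M.lact (ip x y) n) :=
  PreHilbert.ip_toCompletion _ _ _

lemma add_tmul (x y : X) (m : M.toHilbertModule) :
    (tmul (x + y) m : X.tensor M) = tmul x m + tmul y m := by
  rw [tmul, TensorProduct.add_tmul, map_add]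
  rfl

@[elab_as_elim]
lemma tensor_induction {p : X.tensor M → Prop} (isClosed : IsClosed {t | p t})
    (add : ∀ s t, p s → p t → p (s + t)) (tmul : ∀ x m, p (tmul x m)) (t : X.tensor M) : p t := by
  refine (Correspondence.preTensor X M).denseRange_toCompletion.induction_on t isClosed fun s => ?_
  induction s with
  | zero =>
    have h0 := tmul 0 0
    rwa [HilbertModule.tmul, TensorProduct.zero_tmul] at h0
  | add s s' hs hs' =>
    rw [map_add]
    exact add _ _ hs hs'
  | tmul x m => exact tmul x m

end HilbertModule

/-- The positive map `a ↦ ⟨m, a · m⟩`, which controls the norm of `x ⊗ m` since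
`⟨x ⊗ m, x ⊗ m⟩` is its value at `⟨x, x⟩`. -/
def Correspondence.vectorMap (M : Correspondence.{w} A) (m : M.toHilbertModule) : A →ₚ[ℂ] A :=
  PositiveLinearMap.mk₀
    { toFun := fun a => ip m (M.lact a m)
      map_add' := fun a b => by rw [map_add, add_apply, ip_add_right]
      map_smul' := fun c a => by rw [map_smul, smul_apply, ip_smul_right]; rfl } fun a ha => by
    obtain ⟨c, rfl⟩ := exists_eq_star_mul_self ha
    change 0 ≤ ip m (M.lact (star c * c) m)
    rw [map_mul, mul_apply_eq_comp, M.ip_lact, star_star]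
    exact ip_self_nonneg _

lemma HilbertModule.continuous_tmul_left (m : M.toHilbertModule) :
    Continuous fun x : X => (tmul x m : X.tensor M) := by
  let F : X →ₗ[ℂ] X.tensor M :=
    (Correspondence.preTensor X M).toCompletion ∘ₗ
      (TensorProduct.mk ℂ X M.toHilbertModule).flip m
  obtain ⟨C, hC⟩ := (M.vectorMap m).exists_norm_apply_le
  refine (F.mkContinuous √C fun x => ?_).continuous
  calc ‖F x‖ = √‖ip (tmul x m : X.tensor M) (tmul x m)‖ := norm_eq _
    _ = √‖M.vectorMap m (ip x x)‖ := by rw [ip_tmul]; rfl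
    _ ≤ √(C * ‖ip x x‖) := Real.sqrt_le_sqrt (hC _)
    _ = √C * ‖x‖ := by rw [Real.sqrt_mul C.coe_nonneg, norm_eq x]

namespace IPMap

lemma ext_tmul {V : HilbertModule.{w} A} {f g : IPMap (X.tensor M) V}
    (h : ∀ (x : X) (m : M.toHilbertModule), f (tmul x m) = g (tmul x m)) : f = g := by
  refine IPMap.ext fun t => ?_
  induction t using tensor_induction with
  | isClosed => exact isClosed_eq f.continuous g.continuous
  | add s t hs ht => rw [map_add, map_add, hs, ht]
  | tmul x m => exact h x m

lemma tensor_comp (g : IPMap X' X'') (f : IPMap X X') :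
    (g.comp f).tensor M = (g.tensor M).comp (f.tensor M) :=
  ext_tmul fun x m => by
    change _ = g.tensor M (f.tensor M (tmul x m))
    rw [tensor_tmul, tensor_tmul, tensor_tmul]
    rfl

lemma tensor_id : (IPMap.id X).tensor M = IPMap.id (X.tensor M) :=
  ext_tmul fun _ _ => tensor_tmul _ _ _ _

lemma range_tensor_le {f : IPMap X V} {S : Submodule ℂ (V.tensor M)}
    (hS : IsClosed (S : Set (V.tensor M)))
    (h : ∀ (x : X) (m : M.toHilbertModule), tmul (f x) m ∈ S) :
    (f.tensor M).toLinearMap.range ≤ S := by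
  rintro _ ⟨t, rfl⟩
  induction t using tensor_induction with
  | isClosed => exact hS.preimage (f.tensor M).continuous
  | add s t hs ht =>
    rw [map_add]
    exact S.add_mem hs ht
  | tmul x m =>
    rw [tensor_tmul]
    exact h x m

lemma range_tensor_mono {f : IPMap X V} {h : IPMap H V}
    (hfh : f.toLinearMap.range ≤ h.toLinearMap.range) :
    (f.tensor M).toLinearMap.range ≤ (h.tensor M).toLinearMap.range := by
  refine range_tensor_le (h.tensor M).isClosed_range fun x m => ?_
  obtain ⟨y, hy⟩ := hfh ⟨x, rfl⟩
  exact hy ▸ ⟨tmul y m, h.tensor_tmul M y m⟩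

lemma tensor_surjective {f : IPMap X X'} (hf : Function.Surjective f) :
    Function.Surjective (f.tensor M) := by
  have hid : (IPMap.id X').toLinearMap.range ≤ f.toLinearMap.range := fun x _ => hf x
  intro t
  exact range_tensor_mono hid ⟨t, by rw [tensor_id]; rfl⟩

lemma ip_tensor_eq_zero {f : IPMap X V} {g : IPMap W V} (hfg : ∀ x w, ip (f x) (g w) = 0)
    (s : X.tensor M) (t : W.tensor M) : ip (f.tensor M s) (g.tensor M t) = 0 := by
  induction t using tensor_induction with
  | isClosed =>
    exact isClosed_eq (continuous_ip.comp (continuous_const.prodMk (g.tensor M).continuous))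
      continuous_const
  | add t t' ht ht' => rw [map_add, ip_add_right, ht, ht', add_zero]
  | tmul w n =>
    induction s using tensor_induction with
    | isClosed =>
      exact isClosed_eq (continuous_ip.comp ((f.tensor M).continuous.prodMk continuous_const))
        continuous_const
    | add s s' hs hs' => rw [map_add, ip_add_left, hs, hs', add_zero]
    | tmul x m => rw [tensor_tmul, tensor_tmul, ip_tmul, hfg, map_zero, zero_apply, ip_zero_right]

end IPMap

lemma IsOrthogonalSum.tensor {f : IPMap X V} {g : IPMap W V} {h : IPMap H V}
    (hs : IsOrthogonalSum f g h) (M : Correspondence.{u} A) :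
    IsOrthogonalSum (f.tensor M) (g.tensor M) (h.tensor M) where
  ip_eq_zero := IPMap.ip_tensor_eq_zero hs.ip_eq_zero
  range_sup_range := by
    have hortho := HilbertSubmodule.isOrtho_range
      (IPMap.ip_tensor_eq_zero (M := M) hs.ip_eq_zero)
    refine le_antisymm (sup_le (IPMap.range_tensor_mono ?_) (IPMap.range_tensor_mono ?_))
      (IPMap.range_tensor_le hortho.isClosed_sup fun y m => ?_)
    · exact hs.range_sup_range ▸ le_sup_left
    · exact hs.range_sup_range ▸ le_sup_right
    obtain ⟨_, ⟨x, rfl⟩, _, ⟨w, rfl⟩, hy⟩ := Submodule.mem_sup.mp (hs.range_sup_range.ge ⟨y, rfl⟩)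
    rw [← hy, add_tmul, ← IPMap.tensor_tmul, ← IPMap.tensor_tmul]
    exact Submodule.add_mem_sup ⟨_, rfl⟩ ⟨_, rfl⟩

lemma IsOrthogonalSum.tensorStep {f : IPMap X (V.tensor M)} {g : IPMap W (V.tensor M)}
    (hs : IsOrthogonalSum f g (IPMap.id (V.tensor M))) :
    ∀ k, IsOrthogonalSum (f.tensorStep k) (g.tensorStep k) (IPMap.id (V.tensorPow M (k + 1)))
  | 0 => hs
  | k + 1 => by
    have := (hs.tensorStep k).tensor M
    rwa [IPMap.tensor_id] at this

lemma IPMap.iterate_succ (U : IPMap X (X.tensor M)) :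
    ∀ k, U.iterate (k + 1) = ((U.iterate k).tensor M).comp U
  | 0 => by
    change U.comp (IPMap.id X) = ((IPMap.id X).tensor M).comp U
    rw [tensor_id]
    rfl
  | k + 1 => by
    change ((U.tensorStep k).tensor M).comp (U.iterate (k + 1)) =
      (((U.tensorStep k).comp (U.iterate k)).tensor M).comp U
    rw [U.iterate_succ k, tensor_comp]
    rfl

lemma IPMap.iterate_surjective {U : IPMap X (X.tensor M)} (hU : Function.Surjective U) :
    ∀ k, Function.Surjective (U.iterate k)
  | 0 => Function.surjective_id
  | k + 1 => by
    rw [U.iterate_succ k]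
    exact (tensor_surjective (iterate_surjective hU k)).comp hU

end tensor

/-! ### Direct limits -/

section limit

variable {X : ℕ → HilbertModule.{u} A} {T : ∀ k, IPMap (X k) (X (k + 1))}
  {V : HilbertModule.{w} A}

namespace HilbertLimit

lemma toSeqs_self (k : ℕ) (x : X k) : (toSeqs X T k x).1 k = x := by
  change dite _ _ _ = x
  rw [dif_pos le_rfl, transition, Nat.leRecOn_self]
  rfl

lemma toSeqs_succ {j k : ℕ} (h : k ≤ j) (x : X k) :
    (toSeqs X T k x).1 (j + 1) = T j ((toSeqs X T k x).1 j) := by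
  change dite _ _ _ = T j (dite _ _ _)
  rw [dif_pos h, dif_pos (h.trans j.le_succ), transition_succ]

lemma toCompletion_eq_of_apply_eq {x y : seqs X T} {N : ℕ}
    (hx : ∀ k ≥ N, x.1 (k + 1) = T k (x.1 k)) (hy : ∀ k ≥ N, y.1 (k + 1) = T k (y.1 k))
    (hxy : x.1 N = y.1 N) : (pre X T).toCompletion x = (pre X T).toCompletion y := by
  have heq : ∀ k ≥ N, x.1 k = y.1 k := fun k hk => by
    induction k, hk using Nat.le_induction with
    | base => exact hxy
    | succ k hk ih => rw [hx k hk, hy k hk, ih]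
  obtain ⟨k, hip, hk⟩ := ((eventually_seqIp X T (x - y) (x - y)).and
    (Filter.eventually_ge_atTop N)).exists
  rw [← sub_eq_zero, ← map_sub, ← ip_self_eq_zero, PreHilbert.ip_toCompletion]
  exact hip.trans (ip_self_eq_zero.mpr (sub_eq_zero.mpr (heq k hk)))

lemma toCompletion_eq_ι {x : seqs X T} {N : ℕ} (hx : ∀ k ≥ N, x.1 (k + 1) = T k (x.1 k)) :
    (pre X T).toCompletion x = directLimit.ι X T N (x.1 N) :=
  toCompletion_eq_of_apply_eq hx (fun _ hk => toSeqs_succ hk _) (toSeqs_self N _).symm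

variable {g : ∀ k, IPMap (X k) V}

lemma map_apply_eq (hg : ∀ k x, g (k + 1) (T k x) = g k x) {x : seqs X T} {N : ℕ}
    (hx : ∀ k ≥ N, x.1 (k + 1) = T k (x.1 k)) {k : ℕ} (hk : N ≤ k) :
    g k (x.1 k) = g N (x.1 N) := by
  induction k, hk using Nat.le_induction with
  | base => rfl
  | succ k hk ih => rw [hx k hk, hg, ih]

lemma exists_eventually_eq (hg : ∀ k x, g (k + 1) (T k x) = g k x) (x : seqs X T) :
    ∃ v, ∀ᶠ k in Filter.atTop, v = g k (x.1 k) := by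
  obtain ⟨N, hN⟩ := x.2
  exact ⟨g N (x.1 N), Filter.eventually_atTop.mpr ⟨N, fun k hk => (map_apply_eq hg hN hk).symm⟩⟩

/-- The map on the algebraic direct limit that sends `(x_k)` to the eventually constant value of
`g_k x_k`, for a compatible family of maps `g_k`. -/
def seqsLift (hg : ∀ k x, g (k + 1) (T k x) = g k x) : seqs X T →ₗ[ℂ] V :=
  have hv := fun x => (exists_eventually_eq hg x).choose_spec
  { toFun := fun x => (exists_eventually_eq hg x).choose
    map_add' := fun x y => by
      obtain ⟨k, hxy, hx, hy⟩ := ((hv (x + y)).and ((hv x).and (hv y))).exists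
      rw [hxy, hx, hy]
      exact map_add _ _ _
    map_smul' := fun c x => by
      obtain ⟨k, hcx, hx⟩ := ((hv (c • x)).and (hv x)).exists
      rw [hcx, hx]
      exact map_smul _ _ _ }

lemma eventually_seqsLift (hg : ∀ k x, g (k + 1) (T k x) = g k x) (x : seqs X T) :
    ∀ᶠ k in Filter.atTop, seqsLift hg x = g k (x.1 k) :=
  (exists_eventually_eq hg x).choose_spec

lemma ip_seqsLift (hg : ∀ k x, g (k + 1) (T k x) = g k x) (x y : seqs X T) :
    ip (seqsLift hg x) (seqsLift hg y) = (pre X T).ip x y := by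
  obtain ⟨k, hxy, hx, hy⟩ := ((eventually_seqIp X T x y).and
    ((eventually_seqsLift hg x).and (eventually_seqsLift hg y))).exists
  rw [hx, hy, (g k).ip_map]
  exact hxy.symm

end HilbertLimit

namespace directLimit

lemma ι_succ (k : ℕ) (x : X k) : ι X T (k + 1) (T k x) = ι X T k x := by
  refine HilbertLimit.toCompletion_eq_of_apply_eq (N := k + 1)
    (fun _ hj => HilbertLimit.toSeqs_succ hj _)
    (fun _ hj => HilbertLimit.toSeqs_succ (k.le_succ.trans hj) _) ?_
  rw [HilbertLimit.toSeqs_self, HilbertLimit.toSeqs_succ le_rfl, HilbertLimit.toSeqs_self]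

@[elab_as_elim]
lemma induction_on {p : directLimit X T → Prop} (y : directLimit X T)
    (isClosed : IsClosed {y | p y}) (ι : ∀ k x, p (ι X T k x)) : p y := by
  refine (HilbertLimit.pre X T).denseRange_toCompletion.induction_on y isClosed fun x => ?_
  obtain ⟨N, hN⟩ := x.2
  rw [HilbertLimit.toCompletion_eq_ι hN]
  exact ι N _

/-- The map out of the direct limit induced by a compatible family of maps `g_k`. -/
def lift (g : ∀ k, IPMap (X k) V) (hg : ∀ k x, g (k + 1) (T k x) = g k x) :
    IPMap (directLimit X T) V :=
  (HilbertLimit.pre X T).extend (HilbertLimit.seqsLift hg) (HilbertLimit.ip_seqsLift hg)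

lemma lift_ι (g : ∀ k, IPMap (X k) V) (hg : ∀ k x, g (k + 1) (T k x) = g k x) (k : ℕ) (x : X k) :
    lift g hg (ι X T k x) = g k x := by
  refine ((HilbertLimit.pre X T).extend_toCompletion _ _ _).trans ?_
  obtain ⟨j, hj, hkj⟩ := ((HilbertLimit.eventually_seqsLift hg (HilbertLimit.toSeqs X T k x)).and
    (Filter.eventually_ge_atTop k)).exists
  rw [hj, HilbertLimit.map_apply_eq hg (fun _ h => HilbertLimit.toSeqs_succ h x) hkj,
    HilbertLimit.toSeqs_self]

end directLimit

end limit

/-! ### Multi-resolution analysis -/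

namespace MRA

variable {M : Correspondence.{u} A} {Y : HilbertModule.{u} A}

lemma ι_comp_tensorStep (T : IPMap Y (Y.tensor M)) (k : ℕ) :
    (ι T (k + 1)).comp (T.tensorStep k) = ι T k :=
  IPMap.ext (directLimit.ι_succ (X := fun k => Y.tensorPow M k) (T := T.tensorStep) k)

@[elab_as_elim]
lemma limit_induction {T : IPMap Y (Y.tensor M)} {p : limit T → Prop} (y : limit T)
    (isClosed : IsClosed {y | p y}) (ι : ∀ k x, p (ι T (k + 1) x)) : p y := by
  refine directLimit.induction_on (X := fun k => Y.tensorPow M k) (T := T.tensorStep) y isClosed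
    fun k x => ?_
  change p (MRA.ι T k x)
  rw [← ι_comp_tensorStep]
  exact ι k _

lemma monotone_subY (T : IPMap Y (Y.tensor M)) : Monotone fun k => (subY T k).toSubmodule := by
  refine monotone_nat_of_le_succ fun k => ?_
  rintro _ ⟨x, rfl⟩
  exact ⟨T.tensorStep k x, congrArg (fun f => f x) (ι_comp_tensorStep T k)⟩

lemma pairwise_isOrtho_summand (T : IPMap Y (Y.tensor M)) :
    Pairwise fun i j => (summand T i).IsOrtho (summand T j) := by
  have subY_subZ {k l : ℕ} (h : k ≤ l) : (subY T k).IsOrtho (subZ T l) :=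
    fun x hx y hy => hy.2 x (monotone_subY T h hx)
  have subZ_subZ {k l : ℕ} (h : k < l) : (subZ T k).IsOrtho (subZ T l) :=
    fun x hx => subY_subZ h x hx.1
  rintro (_ | k) (_ | l) hkl
  · exact absurd rfl hkl
  · exact subY_subZ l.zero_le
  · exact (subY_subZ k.zero_le).symm
  · rcases Nat.lt_or_gt_of_ne fun h => hkl (congrArg some h) with h | h
    · exact subZ_subZ h
    · exact (subZ_subZ h).symm

lemma tensor_ι_comp_tensorStep (T : IPMap Y (Y.tensor M)) (k : ℕ) :
    ((ι T (k + 1)).tensor M).comp (T.tensorStep (k + 1)) = (ι T k).tensor M := by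
  rw [← ι_comp_tensorStep T k, IPMap.tensor_comp]
  rfl

/-- The map `Y_∞ → Y_∞ ⊗_A M` underlying the isomorphism `R`. Since `R` is prescribed only on the
levels `k + 1` of the direct limit, level `k` is first moved up by `T_k`. -/
def shiftMap (T : IPMap Y (Y.tensor M)) : IPMap (limit T) ((limit T).tensor M) :=
  directLimit.lift (X := fun k => Y.tensorPow M k) (T := T.tensorStep)
    (fun k => ((ι T k).tensor M).comp (T.tensorStep k))
    fun k x => congrArg (fun f => f (T.tensorStep k x)) (tensor_ι_comp_tensorStep T k)

lemma shiftMap_ι (T : IPMap Y (Y.tensor M)) (k : ℕ) (x : Y.tensorPow M (k + 1)) :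
    shiftMap T (ι T (k + 1) x) = (ι T k).tensor M x :=
  (directLimit.lift_ι (X := fun k => Y.tensorPow M k) (T := T.tensorStep) _ _ (k + 1) x).trans
    (congrArg (fun f => f x) (tensor_ι_comp_tensorStep T k))

lemma shiftMap_surjective (T : IPMap Y (Y.tensor M)) : Function.Surjective (shiftMap T) := by
  have tmul_mem_range (y : limit T) (m : M.toHilbertModule) :
      tmul y m ∈ (shiftMap T).toLinearMap.range := by
    induction y using limit_induction with
    | isClosed => exact (shiftMap T).isClosed_range.preimage (continuous_tmul_left m)
    | ι k x =>
      have hx := (shiftMap_ι T (k + 1) (tmul x m)).trans (IPMap.tensor_tmul _ _ _ _)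
      exact ⟨_, hx⟩
  intro t
  induction t using tensor_induction with
  | isClosed => exact (shiftMap T).isClosed_range
  | add s t hs ht => exact (shiftMap T).toLinearMap.range.add_mem hs ht
  | tmul y m => exact tmul_mem_range y m

/-- The isomorphism `R : Y_∞ → Y_∞ ⊗_A M`, which lowers the levels of the direct limit by one. -/
def shift (T : IPMap Y (Y.tensor M)) : HilbertIso (limit T) ((limit T).tensor M) :=
  ⟨shiftMap T, shiftMap_surjective T⟩

lemma eq_shift {T : IPMap Y (Y.tensor M)} {R : HilbertIso (limit T) ((limit T).tensor M)}
    (hR : ∀ k x, R (ι T (k + 1) x) = (ι T k).tensor M x) : R = shift T := by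
  refine HilbertIso.ext fun y => ?_
  induction y using limit_induction with
  | isClosed => exact isClosed_eq R.continuous (shiftMap T).continuous
  | ι k x => exact (hR k x).trans (shiftMap_ι T k x).symm

lemma iterate_succ_comp_ι (T : IPMap Y (Y.tensor M)) (j k : ℕ) :
    ((shiftMap T).iterate (k + 1)).comp (ι T (j + 1)) =
      (((shiftMap T).iterate k).comp (ι T j)).tensor M := by
  have hshift : (shiftMap T).comp (ι T (j + 1)) = (ι T j).tensor M := IPMap.ext (shiftMap_ι T j)
  rw [IPMap.iterate_succ, IPMap.tensor_comp, ← hshift]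
  rfl

section IsAdjointable

variable {T : IPMap Y (Y.tensor M)} (hT : T.IsAdjointable)
include hT

lemma isOrthogonalSum_ι (k : ℕ) : IsOrthogonalSum (ι T k) (subZ T k).incl (ι T (k + 1)) := by
  have hs := (hT.isOrthogonalSum.tensorStep k).comp (ι T (k + 1))
  rw [ι_comp_tensorStep] at hs
  exact hs.ominus

lemma subY_sup_subZ (k : ℕ) :
    (subY T k).toSubmodule ⊔ (subZ T k).toSubmodule = (subY T (k + 1)).toSubmodule := by
  rw [← (subZ T k).range_incl]
  exact (isOrthogonalSum_ι hT k).range_sup_range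

lemma subY_le_range_sumMap (k : ℕ) : (subY T k).toSubmodule ≤
    (hilbertSum.sumMap (pairwise_isOrtho_summand T)).toLinearMap.range := by
  induction k with
  | zero => exact hilbertSum.le_range_sumMap (pairwise_isOrtho_summand T) none
  | succ k ih =>
    rw [← subY_sup_subZ hT]
    exact sup_le ih (hilbertSum.le_range_sumMap (pairwise_isOrtho_summand T) (some k))

lemma exists_iso_hilbertSum :
    ∃ S : HilbertIso (hilbertSum fun i => (summand T i).toModule) (limit T),
      ∀ w, HasSum (fun k : ℕ => (summand T (some k)).incl (hilbertSum.component w (some k)))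
        (S w - (summand T none).incl (hilbertSum.component w none)) := by
  let S := hilbertSum.sumMap (pairwise_isOrtho_summand T)
  have hS : Function.Surjective S := fun y => by
    induction y using limit_induction with
    | isClosed => exact S.isClosed_range
    | ι k x => exact subY_le_range_sumMap hT (k + 1) ⟨x, rfl⟩
  exact ⟨⟨S, hS⟩, fun w =>
    hasSum_some_of_hasSum_option (hilbertSum.hasSum_sumMap (pairwise_isOrtho_summand T) w)⟩

lemma isOrthogonalSum_iterate_comp_ι (k : ℕ) :
    IsOrthogonalSum (((shiftMap T).iterate k).comp (ι T k)) ((subZ T 0).incl.tensorPow M k)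
      (((shiftMap T).iterate k).comp (ι T (k + 1))) := by
  induction k with
  | zero => exact isOrthogonalSum_ι hT 0
  | succ k ih =>
    rw [iterate_succ_comp_ι, iterate_succ_comp_ι]
    exact ih.tensor M

lemma exists_iso_tensorPow_subZ (k : ℕ) :
    ∃ φ : HilbertIso (subZ T k).toModule ((subZ T 0).toModule.tensorPow M k),
      ∀ z, (subZ T 0).incl.tensorPow M k (φ z) = (shiftMap T).iterate k ((subZ T k).incl z) :=
  ((isOrthogonalSum_ι hT k).comp ((shiftMap T).iterate k)).exists_iso
    (isOrthogonalSum_iterate_comp_ι hT k)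

end IsAdjointable

end MRA

end

theorem mainTheorem2 {A : Type v} [NonUnitalCStarAlgebra A] [PartialOrder A] [StarOrderedRing A]
    (M : Correspondence.{u} A) (Y : HilbertModule.{u} A)
    (T : IPMap Y (Y.tensor M)) (hT : T.IsAdjointable) :
    -- `Y_k` is a complemented submodule of `Y_{k+1}`, with complement `Z_k`
    (∀ k, (∀ y ∈ MRA.subY T k, y ∈ MRA.subY T (k + 1)) ∧
      ∀ y ∈ MRA.subY T (k + 1), ∃ p ∈ MRA.subY T k, ∃ q ∈ MRA.subZ T k, y = p + q) ∧
    -- `(y, (z_k)) ↦ y + ∑ z_k` is an isomorphism of `Y_0 ⊕ (⨁_k Z_k)` onto `Y_∞`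
    (∃ S : HilbertIso (hilbertSum fun i => (MRA.summand T i).toModule) (MRA.limit T),
      ∀ w, HasSum (fun k : ℕ => (MRA.summand T (some k)).incl (hilbertSum.component w (some k)))
        (S w - (MRA.summand T none).incl (hilbertSum.component w none))) ∧
    -- there is exactly one isomorphism `R : Y_∞ → Y_∞ ⊗_A M` with `R ∘ ι^{k+1} = ι^k ⊗ id`,
    ∃ R : HilbertIso (MRA.limit T) ((MRA.limit T).tensor M),
      (∀ k x, R (MRA.ι T (k + 1) x) = (MRA.ι T k).tensor M x) ∧
      (∀ R' : HilbertIso (MRA.limit T) ((MRA.limit T).tensor M),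
        (∀ k x, R' (MRA.ι T (k + 1) x) = (MRA.ι T k).tensor M x) → R' = R) ∧
      -- and the isomorphism `R^k` restricts to an isomorphism of `Z_k` onto `Z_0 ⊗_A M^{⊗ k}`
      ∀ k, Function.Surjective (R.toIPMap.iterate k) ∧
        ∃ φ : HilbertIso (MRA.subZ T k).toModule ((MRA.subZ T 0).toModule.tensorPow M k),
          ∀ z, (MRA.subZ T 0).incl.tensorPow M k (φ z) =
            R.toIPMap.iterate k ((MRA.subZ T k).incl z) := by
  refine ⟨fun k => ⟨MRA.monotone_subY T k.le_succ, fun y hy => ?_⟩, MRA.exists_iso_hilbertSum hT,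
    MRA.shift T, MRA.shiftMap_ι T, fun R' => MRA.eq_shift, fun k =>
      ⟨IPMap.iterate_surjective (MRA.shiftMap_surjective T) k, MRA.exists_iso_tensorPow_subZ hT k⟩⟩
  obtain ⟨p, hp, q, hq, hpq⟩ := Submodule.mem_sup.mp ((MRA.subY_sup_subZ hT k).ge hy)
  exact ⟨p, hp, q, hq, hpq.symm⟩
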